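/- Let $d\ge 1$ and let $\mu_X,\Delta_X\in\mathbb R$ be given for every finite $X\subset\mathbb Z^d$. Let $J=\{J_X\}$ and $\widetilde J=\{\widetilde J_X\}$ be families of Gaussian random variables, all mutually independent, such that $J_X$ and $\widetilde J_X$ both have mean $\mu_X$ and variance $\Delta_X^2$ (possibly $0$); $\mathrm{Av}$ denotes the expectation. Assume thermodynamic stability: there is a constant $\bar c<\infty$ such that for all finite nonempty $\Lambda\subset\mathbb Z^d$ $$\frac1{|\Lambda|}\sum_{X\subseteq\Lambda}|\mu_X|\le\bar c,\qquad \frac1{|\Lambda|}\sum_{X\subseteq\Lambda}\Delta_X^2\le\bar c .$$ (Translation invariance of the disorder is not required.) For finite $\Lambda'\subseteq\Lambda\subset\mathbb Z^d$ and $\sigma,\tau\in\{-1,1\}^\Lambda$ put $\sigma_X=\prod_{i\in X}\sigma_i$ for $X\neq\emptyset$, $\sigma_\emptyset=0$, and $$H_{\Lambda'}(\sigma)=-\sum_{X\subseteq\Lambda'}J_X\sigma_X,\quad H_{\Lambda\setminus\Lambda'}(\sigma)=-\sum_{X\subseteq\Lambda,\,X\not\subseteq\Lambda'}J_X\sigma_X,\quad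 \mathcal B_{\Lambda'}(\sigma)=-\sum_{X\subseteq\Lambda'}\mu_X\sigma_X,$$ $$H^0_{\Lambda'}=H_{\Lambda'}-\mathcal B_{\Lambda'},\qquad b_{\Lambda'}(\sigma)=\frac{\mathcal B_{\Lambda'}(\sigma)}{|\Lambda'|},\qquad c_{\Lambda'}(\sigma,\tau)=\frac1{|\Lambda'|}\sum_{X\subseteq\Lambda'}\Delta_X^2\sigma_X\tau_X,$$ and let $\widetilde H_{\Lambda'},\widetilde H^0_{\Lambda'}$ be defined in the same way from $\widetilde J$. Fix $\beta>0$. Given random Hamiltonians $X_t(\sigma)$, $t\in[0,\pi]$, on $\{-1,1\}^\Lambda$, let $\omega_t$ be the random probability measure on $\{-1,1\}^\Lambda$ with weights proportional to $e^{-\beta X_t(\sigma)}$, let $\omega_{t_1,\dots,t_n}=\omega_{t_1}\otimes\cdots\otimes\omega_{t_n}$ be the product measure for $n$ replicas $\sigma^{(1)},\dots,\sigma^{(n)}$, and $\langle\cdot\rangle_{t_1,\dots,t_n}=\mathrm{Av}(\omega_{t_1,\dots,t_n}(\cdot))$. Write $m_k=b_{\Lambda'}(\sigma^{(k)})$, $c_{k,l}=c_{\Lambda'}(\sigma^{(k)},\sigma^{(l)})$,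 and $$k_2(t,s)=\sin^2(t-s),\quad h_1(t,s)=(\cos t-\sin t)(\cos s-\sin s),\quad h_2(t,s)=\sin(t-s)(\cos t-\sin t).$$ Below, $\Lambda,\Lambda'\nearrow\mathbb Z^d$ means that $\Lambda'\subseteq\Lambda$ run through finite sets (along a sequence or net) such that $\Lambda'$ eventually contains every given finite subset of $\mathbb Z^d$. Then: (1) For $X_t=\cos t\,H^0_{\Lambda'}+\sin t\,\widetilde H^0_{\Lambda'}+\mathcal B_{\Lambda'}+H_{\Lambda\setminus\Lambda'}$, $$\lim_{\Lambda,\Lambda'\nearrow\mathbb Z^d}\int_0^\pi\!\!\int_0^\pi dt\,ds\;k_2(t,s)\left(\langle c_{1,2}^2\rangle_{t,s}-2\langle c_{1,2}c_{2,3}\rangle_{t,s,t}+\langle c_{1,2}c_{3,4}\rangle_{t,s,s,t}\right)=0 .$$ (2) For $X_t=\cos t\,H_{\Lambda'}+\sin t\,\widetilde H_{\Lambda'}+H_{\Lambda\setminus\Lambda'}$ and any $a>0$, $$\lim_{\substack{\Lambda,\Lambda'\nearrow\mathbb Z^d\\|\Lambda'|/|\Lambda|\to a}}\Big\{\beta^2\!\int_0^\pi\!\!\int_0^\pi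 dt\,ds\;h_1(t,s)\left[\langle m_1m_2\rangle_{t,s}-\langle m_1\rangle_t\langle m_2\rangle_s\right]+2\beta^3\!\int_0^\pi\!\!\int_0^\pi dt\,ds\;h_2(t,s)\left[\langle m_1c_{1,2}\rangle_{t,s}-\langle m_1c_{2,3}\rangle_{t,s,t}\right]$$ $$-\beta^4\!\int_0^\pi\!\!\int_0^\pi dt\,ds\;k_2(t,s)\left[\langle c_{1,2}^2\rangle_{t,s}-2\langle c_{1,2}c_{2,3}\rangle_{s,t,s}+\langle c_{1,2}c_{3,4}\rangle_{t,s,s,t}\right]\Big\}=0 .$$ -/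

import Mathlib

open MeasureTheory ProbabilityTheory Filter Topology

/-- Sites of the lattice `ℤ^d`. -/
abbrev Site (d : ℕ) : Type := Fin d → ℤ

/-- Ising spin configurations in the finite volume `Λ`; `ℤˣ = {1, -1}`. -/
abbrev SpinConfig {d : ℕ} (Λ : Finset (Site d)) : Type := Λ → ℤˣ

namespace FlipSpinGlass

noncomputable section

/-- `σ_X = ∏_{i ∈ X} σ_i` for nonempty `X ⊆ Λ`, with the convention `σ_∅ = 0`. -/
def spinProd {d : ℕ} {Λ : Finset (Site d)} (X : Finset (Site d)) (σ : SpinConfig Λ) : ℝ :=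
  if X = ∅ then 0 else ∏ i ∈ Finset.univ.filter (fun i : Λ => (i : Site d) ∈ X), ((σ i : ℤ) : ℝ)

/-- `-∑_{X ⊆ Λ'} K_X σ_X` for couplings `K`. With `K = J` this is `H_{Λ'}`, with
`K = J - μ` it is `H⁰_{Λ'}`, and with `K = μ` it is the average `𝓑_{Λ'}`. -/
def hamIn {d : ℕ} {Λ : Finset (Site d)} (K : Finset (Site d) → ℝ) (Λ' : Finset (Site d))
    (σ : SpinConfig Λ) : ℝ :=
  -∑ X ∈ Λ'.powerset, K X * spinProd X σ

/-- `H_{Λ∖Λ'}(σ) = -∑_{X ⊆ Λ, X ⊈ Λ'} K_X σ_X`. -/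
def hamOut {d : ℕ} {Λ : Finset (Site d)} (K : Finset (Site d) → ℝ) (Λ' : Finset (Site d))
    (σ : SpinConfig Λ) : ℝ :=
  -∑ X ∈ Λ.powerset with ¬ X ⊆ Λ', K X * spinProd X σ

/-- Normalized magnetization `b_{Λ'}(σ) = |Λ'|⁻¹ 𝓑_{Λ'}(σ)`. -/
def magn {d : ℕ} {Λ : Finset (Site d)} (μ : Finset (Site d) → ℝ) (Λ' : Finset (Site d))
    (σ : SpinConfig Λ) : ℝ :=
  hamIn μ Λ' σ / (Λ'.card : ℝ)

/-- Normalized covariance `c_{Λ'}(σ,τ) = |Λ'|⁻¹ ∑_{X ⊆ Λ'} Δ_X² σ_X τ_X`. -/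
def cov {d : ℕ} {Λ : Finset (Site d)} (Δ : Finset (Site d) → ℝ) (Λ' : Finset (Site d))
    (σ τ : SpinConfig Λ) : ℝ :=
  (∑ X ∈ Λ'.powerset, Δ X ^ 2 * spinProd X σ * spinProd X τ) / (Λ'.card : ℝ)

/-- Thermodynamic stability of the Hamiltonian with means `μ_X` and variances `Δ_X²`. -/
def ThermoStable {d : ℕ} (μ Δ : Finset (Site d) → ℝ) : Prop :=
  ∃ c : ℝ, ∀ Λ : Finset (Site d), Λ.Nonempty →
    (∑ X ∈ Λ.powerset, |μ X|) / (Λ.card : ℝ) ≤ c ∧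
    (∑ X ∈ Λ.powerset, Δ X ^ 2) / (Λ.card : ℝ) ≤ c

/-- `J` and `Jt` are two families of Gaussian variables, all of them jointly independent, with
`J_X` and `Jt_X` of mean `μ_X` and variance `Δ_X²` (possibly zero). -/
structure IsGaussianDisorder {d : ℕ} {Ω : Type*} [MeasurableSpace Ω] (P : Measure Ω)
    (μ Δ : Finset (Site d) → ℝ) (J Jt : Finset (Site d) → Ω → ℝ) : Prop where
  law : ∀ X, HasLaw (J X) (gaussianReal (μ X) (Real.toNNReal (Δ X ^ 2))) P
  law_copy : ∀ X, HasLaw (Jt X) (gaussianReal (μ X) (Real.toNNReal (Δ X ^ 2))) P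
  indep : iIndepFun (Sum.elim J Jt) P

/-- Full flip: `cos t H_{Λ'} + sin t H̃_{Λ'} + H_{Λ∖Λ'}`. -/
def flipHam {d : ℕ} {Ω : Type*} (J Jt : Finset (Site d) → Ω → ℝ) (Λ Λ' : Finset (Site d))
    (t : ℝ) (w : Ω) (σ : SpinConfig Λ) : ℝ :=
  Real.cos t * hamIn (fun X => J X w) Λ' σ + Real.sin t * hamIn (fun X => Jt X w) Λ' σ
    + hamOut (fun X => J X w) Λ' σ

/-- Flip of the centered part: `cos t H⁰_{Λ'} + sin t H̃⁰_{Λ'} + 𝓑_{Λ'} + H_{Λ∖Λ'}`. -/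
def centeredFlipHam {d : ℕ} {Ω : Type*} (μ : Finset (Site d) → ℝ)
    (J Jt : Finset (Site d) → Ω → ℝ) (Λ Λ' : Finset (Site d))
    (t : ℝ) (w : Ω) (σ : SpinConfig Λ) : ℝ :=
  Real.cos t * hamIn (fun X => J X w - μ X) Λ' σ
    + Real.sin t * hamIn (fun X => Jt X w - μ X) Λ' σ
    + hamIn μ Λ' σ + hamOut (fun X => J X w) Λ' σ

/-- Boltzmann weight `e^{-β E(σ)} / ∑_τ e^{-β E(τ)}`. -/
def boltzmann {d : ℕ} {Λ : Finset (Site d)} (β : ℝ) (E : SpinConfig Λ → ℝ)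
    (σ : SpinConfig Λ) : ℝ :=
  Real.exp (-β * E σ) / ∑ τ : SpinConfig Λ, Real.exp (-β * E τ)

/-- Random state `ω_{t_1,…,t_n}(f)` of `n` replicas, the `k`-th one with energy `E k`. -/
def randomState {d : ℕ} {Λ : Finset (Site d)} {n : ℕ} (β : ℝ)
    (E : Fin n → SpinConfig Λ → ℝ) (f : (Fin n → SpinConfig Λ) → ℝ) : ℝ :=
  ∑ σ : Fin n → SpinConfig Λ, f σ * ∏ k, boltzmann β (E k) (σ k)

/-- Quenched state `⟨f⟩_{t_1,…,t_n} = Av(ω_{t_1,…,t_n}(f))` of the parametrized Hamiltonian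
`H t`; replicas are numbered from `0`, so replica `k + 1` of the text is `σ k`. -/
def quenched {d : ℕ} {Λ : Finset (Site d)} {Ω : Type*} [MeasurableSpace Ω] {n : ℕ}
    (P : Measure Ω) (β : ℝ) (H : ℝ → Ω → SpinConfig Λ → ℝ) (t : Fin n → ℝ)
    (f : (Fin n → SpinConfig Λ) → ℝ) : ℝ :=
  ∫ w, randomState β (fun k => H (t k) w) f ∂P

def h₁ (t s : ℝ) : ℝ := (Real.cos t - Real.sin t) * (Real.cos s - Real.sin s)

def h₂ (t s : ℝ) : ℝ := Real.sin (t - s) * (Real.cos t - Real.sin t)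

def k₂ (t s : ℝ) : ℝ := Real.sin (t - s) ^ 2

end

end FlipSpinGlass

/-!
The logarithm of the ratio of the partition functions at the angles `π` and `0` is
`-β ∫₀^π ω_t(dX_t/dt) dt`. Gaussian integration by parts turns the disorder average of
`ω_t(dX_t/dt) ω_s(dX_s/ds)` into replica overlaps, so the double integrals of the theorem are, up to
the normalization `|Λ'|²`, moments of this logarithm.

Rotating by `π` changes the sign of the rotated couplings. In part (1) the logarithm is therefore
odd in them, and the Efron–Stein inequality bounds its second moment by `O(|Λ'|)`. In part (2) the
same inequality bounds its variance by `O(|Λ|)`. The `h₂` integral is negligible by itself: `d/dt`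
of the averaged magnetization is a thermal variance times `cos t - sin t`, which changes sign only
once, so the thermal fluctuations of the magnetization are small for most angles.
-/

namespace FlipSpinGlass

noncomputable section

/-! ### Gaussian integration by parts -/

/-- The law of a finite family of independent standard Gaussian variables. -/
abbrev stdGaussianPi (K : Type*) [Fintype K] : Measure (K → ℝ) :=
  Measure.pi fun _ => gaussianReal 0 1

/-- A jointly continuous family of functions of polynomial growth, locally uniformly in the
parameter; a single function is treated as a family indexed by `Unit`. -/
def PolyGrowth {T K : Type*} [TopologicalSpace T] [Fintype K] (Φ : T → (K → ℝ) → ℝ) : Prop :=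
  Continuous (fun p : T × (K → ℝ) => Φ p.1 p.2) ∧
    ∃ C : T → ℝ, Continuous C ∧ ∃ n : ℕ, ∀ t g, |Φ t g| ≤ C t * (1 + ‖g‖) ^ n

namespace PolyGrowth

variable {T T' K : Type*} [TopologicalSpace T] [TopologicalSpace T'] [Fintype K]
  {Φ Ψ : T → (K → ℝ) → ℝ}

lemma of_bounded {C : ℝ} (hc : Continuous fun p : T × (K → ℝ) => Φ p.1 p.2)
    (hb : ∀ t g, |Φ t g| ≤ C) : PolyGrowth Φ :=
  ⟨hc, fun _ => C, continuous_const, 0, fun t g => by simpa using hb t g⟩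

lemma of_param {φ : T → ℝ} (hφ : Continuous φ) : PolyGrowth fun t (_ : K → ℝ) => φ t :=
  ⟨hφ.comp continuous_fst, fun t => |φ t|, hφ.abs, 0, fun t _ => by simp⟩

lemma const (c : ℝ) : PolyGrowth fun (_ : T) (_ : K → ℝ) => c :=
  of_param continuous_const

lemma coord (k : K) : PolyGrowth fun (_ : T) (g : K → ℝ) => g k := by
  refine ⟨by fun_prop, fun _ => 1, continuous_const, 1, fun t g => ?_⟩
  have := norm_le_pi_norm g k
  rw [Real.norm_eq_abs] at this
  linarith

lemma mul (hΦ : PolyGrowth Φ) (hΨ : PolyGrowth Ψ) : PolyGrowth fun t g => Φ t g * Ψ t g := by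
  obtain ⟨hΦc, C, hC, n, hn⟩ := hΦ
  obtain ⟨hΨc, D, hD, m, hm⟩ := hΨ
  refine ⟨hΦc.mul hΨc, fun t => C t * D t, hC.mul hD, n + m, fun t g => ?_⟩
  rw [abs_mul, pow_add, mul_mul_mul_comm]
  exact mul_le_mul (hn t g) (hm t g) (abs_nonneg _) ((abs_nonneg _).trans (hn t g))

lemma add (hΦ : PolyGrowth Φ) (hΨ : PolyGrowth Ψ) : PolyGrowth fun t g => Φ t g + Ψ t g := by
  obtain ⟨hΦc, C, hC, n, hn⟩ := hΦ
  obtain ⟨hΨc, D, hD, m, hm⟩ := hΨ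
  refine ⟨hΦc.add hΨc, fun t => |C t| + |D t|, hC.abs.add hD.abs, n + m, fun t g => ?_⟩
  have one_le : (1 : ℝ) ≤ 1 + ‖g‖ := by linarith [norm_nonneg g]
  calc |Φ t g + Ψ t g| ≤ |Φ t g| + |Ψ t g| := abs_add_le _ _
    _ ≤ |C t| * (1 + ‖g‖) ^ n + |D t| * (1 + ‖g‖) ^ m :=
      add_le_add ((hn t g).trans (by gcongr; exact le_abs_self _))
        ((hm t g).trans (by gcongr; exact le_abs_self _))
    _ ≤ |C t| * (1 + ‖g‖) ^ (n + m) + |D t| * (1 + ‖g‖) ^ (n + m) := by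
      gcongr <;> first | exact one_le | omega
    _ = (|C t| + |D t|) * (1 + ‖g‖) ^ (n + m) := by ring

lemma const_mul (c : ℝ) (hΦ : PolyGrowth Φ) : PolyGrowth fun t g => c * Φ t g :=
  (const c).mul hΦ

lemma sub (hΦ : PolyGrowth Φ) (hΨ : PolyGrowth Ψ) : PolyGrowth fun t g => Φ t g - Ψ t g := by
  simpa [sub_eq_add_neg] using hΦ.add (hΨ.const_mul (-1))

lemma sq (hΦ : PolyGrowth Φ) : PolyGrowth fun t g => Φ t g ^ 2 := by
  simpa [pow_two] using hΦ.mul hΦ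

lemma sum {ι : Type*} {s : Finset ι} {F : ι → T → (K → ℝ) → ℝ}
    (h : ∀ i ∈ s, PolyGrowth (F i)) : PolyGrowth fun t g => ∑ i ∈ s, F i t g := by
  classical
  induction s using Finset.induction_on with
  | empty => simpa using const 0
  | insert a s ha ih =>
    simp_rw [Finset.sum_insert ha]
    exact (h a (by simp)).add (ih fun i hi => h i (by simp [hi]))

lemma comp (hΦ : PolyGrowth Φ) {φ : T' → T} (hφ : Continuous φ) :
    PolyGrowth fun t => Φ (φ t) := by
  obtain ⟨hc, C, hC, n, hn⟩ := hΦ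
  exact ⟨hc.comp (by fun_prop : Continuous fun p : T' × (K → ℝ) => (φ p.1, p.2)),
    fun t => C (φ t), hC.comp hφ, n, fun t g => hn _ g⟩

lemma at_param (hΦ : PolyGrowth Φ) (t : T) : PolyGrowth fun _ : Unit => Φ t :=
  hΦ.comp continuous_const

lemma continuous_right (hΦ : PolyGrowth Φ) (t : T) : Continuous (Φ t) :=
  hΦ.1.comp (by fun_prop : Continuous fun g : K → ℝ => (t, g))

lemma continuous_left (hΦ : PolyGrowth Φ) (g : K → ℝ) : Continuous fun t => Φ t g :=
  hΦ.1.comp (by fun_prop : Continuous fun t : T => (t, g))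

end PolyGrowth

section GaussianIntegrals

variable {T K : Type*} [TopologicalSpace T] [Fintype K] {Φ : T → (K → ℝ) → ℝ}

lemma memLp_eval_stdGaussianPi (k : K) (n : ℕ) :
    MemLp (fun g : K → ℝ => g k) n (stdGaussianPi K) := by
  have h : MemLp id n (gaussianReal 0 1) := by
    simpa using memLp_id_gaussianReal (μ := 0) (v := 1) (n : NNReal)
  exact h.comp_measurePreserving (measurePreserving_eval (fun _ : K => gaussianReal 0 1) k)

lemma integrable_one_add_norm_pow (n : ℕ) :
    Integrable (fun g : K → ℝ => (1 + ‖g‖) ^ n) (stdGaussianPi K) := by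
  have hsum : MemLp (fun g : K → ℝ => ∑ k, ‖g k‖) n (stdGaussianPi K) :=
    memLp_finsetSum Finset.univ fun k _ => (memLp_eval_stdGaussianPi k n).norm
  refine ((memLp_const (1 : ℝ)).add hsum).integrable_norm_pow'.mono' (by fun_prop)
    (ae_of_all _ fun g => ?_)
  have sum_nonneg : 0 ≤ ∑ k, ‖g k‖ := Finset.sum_nonneg fun _ _ => norm_nonneg _
  have norm_le_sum : ‖g‖ ≤ ∑ k, ‖g k‖ := (pi_norm_le_iff_of_nonneg sum_nonneg).2 fun k =>
    Finset.single_le_sum (f := fun k => ‖g k‖) (fun _ _ => norm_nonneg _) (Finset.mem_univ k)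
  rw [norm_pow, Real.norm_of_nonneg (by positivity : 0 ≤ 1 + ‖g‖), Pi.add_apply,
    Real.norm_of_nonneg (by positivity : 0 ≤ 1 + ∑ k, ‖g k‖)]
  gcongr

lemma PolyGrowth.integrable (hΦ : PolyGrowth Φ) (t : T) : Integrable (Φ t) (stdGaussianPi K) := by
  obtain ⟨C, -, n, hn⟩ := hΦ.2
  exact ((integrable_one_add_norm_pow n).const_mul (C t)).mono'
    (hΦ.continuous_right t).aestronglyMeasurable (ae_of_all _ (hn t))

lemma PolyGrowth.memLp_two (hΦ : PolyGrowth Φ) (t : T) : MemLp (Φ t) 2 (stdGaussianPi K) :=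
  (memLp_two_iff_integrable_sq (hΦ.continuous_right t).aestronglyMeasurable).2
    (hΦ.sq.integrable t)

lemma PolyGrowth.continuous_integral [FirstCountableTopology T] (hΦ : PolyGrowth Φ) :
    Continuous fun t => ∫ g, Φ t g ∂stdGaussianPi K := by
  obtain ⟨C, hC, n, hn⟩ := hΦ.2
  refine continuous_iff_continuousAt.2 fun t₀ => ?_
  have hlocal : ∀ᶠ t in 𝓝 t₀, C t ≤ C t₀ + 1 :=
    (hC.continuousAt.eventually_lt_const (lt_add_one (C t₀))).mono fun _ => le_of_lt
  refine continuousAt_of_dominated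
    (Eventually.of_forall fun t => (hΦ.continuous_right t).aestronglyMeasurable)
    (hlocal.mono fun t ht => ae_of_all _ fun g => (hn t g).trans (by gcongr))
    ((integrable_one_add_norm_pow n).const_mul (C t₀ + 1))
    (ae_of_all _ fun g => (hΦ.continuous_left g).continuousAt)

lemma PolyGrowth.intervalIntegral_integral_swap {Φ : ℝ → (K → ℝ) → ℝ} (hΦ : PolyGrowth Φ)
    (a b : ℝ) : ∫ t in a..b, ∫ g, Φ t g ∂stdGaussianPi K
      = ∫ g, (∫ t in a..b, Φ t g) ∂stdGaussianPi K := by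
  obtain ⟨C, hC, n, hn⟩ := hΦ.2
  refine MeasureTheory.intervalIntegral_integral_swap ?_
  have hC_int : Integrable C (volume.restrict (Set.uIoc a b)) :=
    (hC.integrableOn_uIcc (a := a) (b := b)).mono_set Set.uIoc_subset_uIcc
  exact (hC_int.mul_prod (integrable_one_add_norm_pow (K := K) n)).mono'
    hΦ.1.aestronglyMeasurable (ae_of_all _ fun p => hn p.1 p.2)

/-- The density of `stdGaussianPi K` with respect to Lebesgue measure. -/
def stdGaussianDensity (g : K → ℝ) : ℝ := ∏ k, gaussianPDFReal 0 1 (g k)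

lemma stdGaussianDensity_nonneg (g : K → ℝ) : 0 ≤ stdGaussianDensity g :=
  Finset.prod_nonneg fun _ _ => gaussianPDFReal_nonneg _ _ _

lemma measurable_stdGaussianDensity : Measurable (stdGaussianDensity (K := K)) :=
  Finset.measurable_fun_prod _ fun k _ =>
    (measurable_gaussianPDFReal 0 1).comp (measurable_pi_apply k)

lemma stdGaussianPi_eq_withDensity :
    stdGaussianPi K
      = volume.withDensity (fun g : K → ℝ => ENNReal.ofReal (stdGaussianDensity g)) := by
  refine Measure.pi_eq fun s hs => ?_
  have pdf_integrable (k : K) : Integrable (gaussianPDFReal 0 1) (volume.restrict (s k)) :=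
    (integrable_gaussianPDFReal 0 1).restrict
  have density_integrable : Integrable (stdGaussianDensity (K := K))
      (Measure.pi fun k => volume.restrict (s k)) := Integrable.fintype_prod pdf_integrable
  rw [withDensity_apply _ (MeasurableSet.univ_pi hs), volume_pi, Measure.restrict_pi_pi,
    ← ofReal_integral_eq_lintegral_ofReal density_integrable
      (ae_of_all _ stdGaussianDensity_nonneg)]
  unfold stdGaussianDensity
  rw [integral_fintype_prod_eq_prod (fun _ => gaussianPDFReal 0 1),
    ENNReal.ofReal_prod_of_nonneg fun k _ => integral_nonneg (gaussianPDFReal_nonneg 0 1)]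
  exact Finset.prod_congr rfl fun k _ => (gaussianReal_apply_eq_integral _ one_ne_zero _).symm

lemma integral_stdGaussianPi (F : (K → ℝ) → ℝ) :
    ∫ g, F g ∂stdGaussianPi K = ∫ g, F g * stdGaussianDensity g := by
  rw [stdGaussianPi_eq_withDensity, integral_withDensity_eq_integral_toReal_smul
    measurable_stdGaussianDensity.ennreal_ofReal (by simp)]
  simp [ENNReal.toReal_ofReal (stdGaussianDensity_nonneg _), mul_comm]

lemma integrable_mul_stdGaussianDensity {F : (K → ℝ) → ℝ} (hF : Integrable F (stdGaussianPi K)) :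
    Integrable fun g => F g * stdGaussianDensity g := by
  rw [stdGaussianPi_eq_withDensity, integrable_withDensity_iff_integrable_smul'
    measurable_stdGaussianDensity.ennreal_ofReal (by simp)] at hF
  simpa [ENNReal.toReal_ofReal (stdGaussianDensity_nonneg _), mul_comm] using hF

lemma hasDerivAt_gaussianPDFReal_zero_one (x : ℝ) :
    HasDerivAt (gaussianPDFReal 0 1) (-x * gaussianPDFReal 0 1 x) x := by
  have exponent : HasDerivAt (fun x : ℝ => -(x - 0) ^ 2 / (2 * ((1 : NNReal) : ℝ))) (-x) x := by
    refine ((((hasDerivAt_id x).sub_const 0).pow 2).neg.div_const _).congr_deriv ?_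
    simp only [id, NNReal.coe_one]
    ring
  rw [gaussianPDFReal_def]
  exact (exponent.exp.const_mul _).congr_deriv (by ring)

lemma hasLineDerivAt_stdGaussianDensity (g u : K → ℝ) :
    HasLineDerivAt ℝ stdGaussianDensity (-(∑ k, u k * g k) * stdGaussianDensity g) g u := by
  classical
  have factor (k : K) : HasDerivAt (fun ε : ℝ => gaussianPDFReal 0 1 ((g + ε • u) k))
      (-(u k * g k) * gaussianPDFReal 0 1 (g k)) 0 := by
    have line : HasDerivAt (fun ε : ℝ => (g + ε • u) k) (u k) 0 := by
      simpa using ((hasDerivAt_id (0 : ℝ)).mul_const (u k)).const_add (g k)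
    refine ((hasDerivAt_gaussianPDFReal_zero_one _).comp (0 : ℝ) line).congr_deriv ?_
    simp only [zero_smul, add_zero]
    ring
  refine (HasDerivAt.fun_finsetProd (u := Finset.univ) fun k _ => factor k).congr_deriv ?_
  simp only [zero_smul, add_zero, smul_eq_mul]
  rw [← Finset.sum_neg_distrib, Finset.sum_mul]
  refine Finset.sum_congr rfl fun k _ => ?_
  rw [stdGaussianDensity, ← Finset.mul_prod_erase Finset.univ _ (Finset.mem_univ k)]
  ring

theorem integral_stdGaussianPi_by_parts {F F' : (K → ℝ) → ℝ} (u : K → ℝ)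
    (hF : Integrable F (stdGaussianPi K)) (hF' : Integrable F' (stdGaussianPi K))
    (hFu : Integrable (fun g => (∑ k, u k * g k) * F g) (stdGaussianPi K))
    (h : ∀ g, HasLineDerivAt ℝ F (F' g) g u) :
    ∫ g, (∑ k, u k * g k) * F g ∂stdGaussianPi K = ∫ g, F' g ∂stdGaussianPi K := by
  have ibp := integral_bilinear_hasLineDerivAt_right_eq_neg_left_of_integrable
    (μ := (volume : Measure (K → ℝ))) (f := F) (f' := F') (g := stdGaussianDensity)
    (g' := fun g => -(∑ k, u k * g k) * stdGaussianDensity g) (v := u)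
    (B := ContinuousLinearMap.mul ℝ ℝ) (by simpa using integrable_mul_stdGaussianDensity hF')
    ((integrable_mul_stdGaussianDensity hFu).neg.congr
      (ae_of_all _ fun g => by simp only [Pi.neg_apply, ContinuousLinearMap.mul_apply']; ring))
    (by simpa using integrable_mul_stdGaussianDensity hF)
    (fun g _ => h g) (fun g _ => hasLineDerivAt_stdGaussianDensity g u)
  simp only [ContinuousLinearMap.mul_apply'] at ibp
  rw [integral_stdGaussianPi, integral_stdGaussianPi, ← neg_inj, ← ibp, ← integral_neg]
  exact integral_congr_ae (ae_of_all _ fun g => by ring)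

end GaussianIntegrals

/-! ### The Efron–Stein inequality -/

section EfronStein

/-- The joint law of two independent copies of a random vector with independent coordinates. -/
abbrev twoCopies {ι Ω : Type*} [MeasurableSpace Ω] [Fintype ι] (ν : ι → Measure Ω) :
    Measure ((ι → Ω) × (ι → Ω)) :=
  (Measure.pi ν).prod (Measure.pi ν)

lemma memLp_fst {ι Ω : Type*} [MeasurableSpace Ω] [Fintype ι] {ν : ι → Measure Ω}
    [∀ i, IsProbabilityMeasure (ν i)] {f : (ι → Ω) → ℝ} (hf : MemLp f 2 (Measure.pi ν)) :
    MemLp (fun p => f p.1) 2 (twoCopies ν) :=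
  hf.comp_measurePreserving measurePreserving_fst

variable {ι Ω : Type*} [DecidableEq ι]

/-- Exchange the coordinates in `s` between the two points of a pair; the first component is the
point whose coordinates in `s` have been resampled. -/
def exchange (s : Finset ι) (p : (ι → Ω) × (ι → Ω)) : (ι → Ω) × (ι → Ω) :=
  (s.piecewise p.2 p.1, s.piecewise p.1 p.2)

lemma exchange_empty (p : (ι → Ω) × (ι → Ω)) : exchange ∅ p = p := by
  simp [exchange]

lemma exchange_univ [Fintype ι] (p : (ι → Ω) × (ι → Ω)) : exchange Finset.univ p = p.swap := by
  simp [exchange, Prod.swap]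

lemma exchange_singleton_fst (i : ι) (p : (ι → Ω) × (ι → Ω)) :
    (exchange {i} p).1 = Function.update p.1 i (p.2 i) :=
  Finset.piecewise_singleton _ _ _

lemma exchange_exchange (s t : Finset ι) (p : (ι → Ω) × (ι → Ω)) :
    exchange s (exchange t p) = exchange (symmDiff s t) p := by
  refine Prod.ext (funext fun i => ?_) (funext fun i => ?_) <;>
    by_cases hs : i ∈ s <;> by_cases ht : i ∈ t <;> simp [exchange, Finset.mem_symmDiff, hs, ht]

lemma involutive_exchange (s : Finset ι) :
    Function.Involutive (exchange s : (ι → Ω) × (ι → Ω) → (ι → Ω) × (ι → Ω)) := fun p => by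
  rw [exchange_exchange, symmDiff_self, Finset.bot_eq_empty, exchange_empty]

lemma exchange_exchange_singleton {s : Finset ι} {i : ι} (hi : i ∉ s) (p : (ι → Ω) × (ι → Ω)) :
    exchange s (exchange {i} p) = exchange (insert i s) p := by
  rw [exchange_exchange, (Finset.disjoint_singleton_right.2 hi).symmDiff_eq_sup,
    Finset.sup_eq_union, Finset.union_comm, ← Finset.insert_eq]

lemma exchange_singleton_exchange {s : Finset ι} {i : ι} (hi : i ∉ s) (p : (ι → Ω) × (ι → Ω)) :
    exchange {i} (exchange s p) = exchange (insert i s) p := by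
  rw [exchange_exchange, symmDiff_comm, ← exchange_exchange, exchange_exchange_singleton hi]

lemma exchange_insert_exchange_singleton {s : Finset ι} {i : ι} (hi : i ∉ s)
    (p : (ι → Ω) × (ι → Ω)) : exchange (insert i s) (exchange {i} p) = exchange s p := by
  rw [← exchange_exchange_singleton hi, involutive_exchange]

variable [MeasurableSpace Ω] [Fintype ι] {ν : ι → Measure Ω} [∀ i, IsProbabilityMeasure (ν i)]
  {f : (ι → Ω) → ℝ}

lemma measurePreserving_exchange (s : Finset ι) :
    MeasurePreserving (exchange s) (twoCopies ν) (twoCopies ν) := by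
  have pairs := measurePreserving_arrowProdEquivProdArrow Ω Ω ι ν ν
  have coordinate (i : ι) : MeasurePreserving (if i ∈ s then Prod.swap else id)
      ((ν i).prod (ν i)) ((ν i).prod (ν i)) := by
    split_ifs
    · exact Measure.measurePreserving_swap
    · exact MeasurePreserving.id _
  convert! (pairs.comp (measurePreserving_pi _ _ coordinate)).comp pairs.symm using 1
  funext p
  refine Prod.ext (funext fun i => ?_) (funext fun i => ?_) <;> by_cases hi : i ∈ s <;>
    simp [exchange, hi, MeasurableEquiv.arrowProdEquivProdArrow, Equiv.arrowProdEquivProdArrow]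

lemma integral_comp_exchange (s : Finset ι) (F : (ι → Ω) × (ι → Ω) → ℝ) :
    ∫ p, F (exchange s p) ∂twoCopies ν = ∫ p, F p ∂twoCopies ν :=
  have hs := measurePreserving_exchange (ν := ν) s
  hs.integral_comp
    (MeasurableEquiv.ofInvolutive _ (involutive_exchange s) hs.measurable).measurableEmbedding F

lemma memLp_exchange_fst (hf : MemLp f 2 (Measure.pi ν)) (s : Finset ι) :
    MemLp (fun p => f (exchange s p).1) 2 (twoCopies ν) :=
  (memLp_fst hf).comp_measurePreserving (measurePreserving_exchange s)

lemma memLp_update (hf : MemLp f 2 (Measure.pi ν)) (i : ι) :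
    MemLp (fun p => f (Function.update p.1 i (p.2 i))) 2 (twoCopies ν) := by
  simpa only [exchange_singleton_fst] using memLp_exchange_fst hf {i}

lemma integral_sq_exchange_sub_exchange_insert {s : Finset ι} {i : ι} (hi : i ∉ s) :
    ∫ p, (f (exchange s p).1 - f (exchange (insert i s) p).1) ^ 2 ∂twoCopies ν
      = ∫ p, (f p.1 - f (Function.update p.1 i (p.2 i))) ^ 2 ∂twoCopies ν := by
  rw [← integral_comp_exchange s fun p => (f p.1 - f (Function.update p.1 i (p.2 i))) ^ 2]
  simp_rw [← exchange_singleton_fst, exchange_singleton_exchange hi]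

-- Exchanging the `i`-th coordinates changes the sign of the difference.
lemma integral_mul_exchange_sub_exchange_insert (hf : MemLp f 2 (Measure.pi ν)) {s : Finset ι}
    {i : ι} (hi : i ∉ s) :
    ∫ p, f p.1 * (f (exchange s p).1 - f (exchange (insert i s) p).1) ∂twoCopies ν
      = ∫ p, (f p.1 - f (Function.update p.1 i (p.2 i))) / 2
          * (f (exchange s p).1 - f (exchange (insert i s) p).1) ∂twoCopies ν := by
  set D : (ι → Ω) × (ι → Ω) → ℝ :=
    fun p => f (exchange s p).1 - f (exchange (insert i s) p).1 with hD
  have D_memLp : MemLp D 2 (twoCopies ν) := (memLp_exchange_fst hf s).sub (memLp_exchange_fst hf _)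
  have antisymm : ∫ p, f p.1 * D p ∂twoCopies ν
      = -∫ p, f (Function.update p.1 i (p.2 i)) * D p ∂twoCopies ν := by
    rw [← integral_comp_exchange {i}, ← integral_neg]
    refine integral_congr_ae (ae_of_all _ fun p => ?_)
    simp only [hD, exchange_exchange_singleton hi, exchange_insert_exchange_singleton hi,
      exchange_singleton_fst]
    ring
  have split : ∫ p, (f p.1 - f (Function.update p.1 i (p.2 i))) * D p ∂twoCopies ν
      = ∫ p, f p.1 * D p ∂twoCopies ν
        - ∫ p, f (Function.update p.1 i (p.2 i)) * D p ∂twoCopies ν := by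
    simp_rw [sub_mul]
    exact integral_sub ((memLp_fst hf).integrable_mul D_memLp)
      ((memLp_update hf i).integrable_mul D_memLp)
  simp_rw [div_mul_eq_mul_div]
  rw [integral_div, split]
  linarith

theorem integral_mul_sub_exchange_le (hf : MemLp f 2 (Measure.pi ν)) (s : Finset ι) :
    ∫ p, f p.1 * (f p.1 - f (exchange s p).1) ∂twoCopies ν
      ≤ ∑ i ∈ s, (∫ p, (f p.1 - f (Function.update p.1 i (p.2 i))) ^ 2 ∂twoCopies ν) / 2 := by
  induction s using Finset.induction_on with
  | empty => simp [exchange_empty]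
  | insert i s hi ih =>
    set A : (ι → Ω) × (ι → Ω) → ℝ := fun p => f p.1 - f (Function.update p.1 i (p.2 i))
    set D : (ι → Ω) × (ι → Ω) → ℝ := fun p => f (exchange s p).1 - f (exchange (insert i s) p).1
      with hD
    have A_memLp : MemLp A 2 (twoCopies ν) := (memLp_fst hf).sub (memLp_update hf i)
    have D_memLp : MemLp D 2 (twoCopies ν) :=
      (memLp_exchange_fst hf s).sub (memLp_exchange_fst hf _)
    have increment : ∫ p, f p.1 * D p ∂twoCopies ν ≤ (∫ p, A p ^ 2 ∂twoCopies ν) / 2 :=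
      calc ∫ p, f p.1 * D p ∂twoCopies ν
          = ∫ p, A p / 2 * D p ∂twoCopies ν := integral_mul_exchange_sub_exchange_insert hf hi
        _ ≤ ∫ p, (A p ^ 2 / 4 + D p ^ 2 / 4) ∂twoCopies ν :=
          integral_mono ((A_memLp.integrable_mul D_memLp).div_const 2 |>.congr
              (ae_of_all _ fun p => by simp only [Pi.mul_apply]; ring))
            ((A_memLp.integrable_sq.div_const 4).add (D_memLp.integrable_sq.div_const 4))
            fun p => by nlinarith [sq_nonneg (A p - D p)]
        _ = (∫ p, A p ^ 2 ∂twoCopies ν) / 2 := by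
          rw [integral_add (A_memLp.integrable_sq.div_const 4) (D_memLp.integrable_sq.div_const 4),
            integral_div, integral_div, integral_sq_exchange_sub_exchange_insert hi]
          ring
    calc ∫ p, f p.1 * (f p.1 - f (exchange (insert i s) p).1) ∂twoCopies ν
        = ∫ p, (f p.1 * (f p.1 - f (exchange s p).1) + f p.1 * D p) ∂twoCopies ν :=
          integral_congr_ae (ae_of_all _ fun p => by simp only [hD]; ring)
      _ = ∫ p, f p.1 * (f p.1 - f (exchange s p).1) ∂twoCopies ν
            + ∫ p, f p.1 * D p ∂twoCopies ν :=
          integral_add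
            ((memLp_fst hf).integrable_mul ((memLp_fst hf).sub (memLp_exchange_fst hf s)))
            ((memLp_fst hf).integrable_mul D_memLp)
      _ ≤ _ := by rw [Finset.sum_insert hi]; linarith

end EfronStein

section IndependentCopies

variable {Ω : Type*} [MeasurableSpace Ω] {μ : Measure Ω} [IsProbabilityMeasure μ] {X : Ω → ℝ}

lemma integral_mul_sub_eq_variance (hX : MemLp X 2 μ) :
    ∫ p, X p.1 * (X p.1 - X p.2) ∂μ.prod μ = Var[X; μ] := by
  have sq_integrable : Integrable (fun p : Ω × Ω => X p.1 ^ 2) (μ.prod μ) :=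
    hX.integrable_sq.comp_fst μ
  have mul_integrable : Integrable (fun p : Ω × Ω => X p.1 * X p.2) (μ.prod μ) :=
    (hX.integrable one_le_two).mul_prod (hX.integrable one_le_two)
  simp_rw [mul_sub, ← pow_two]
  rw [integral_sub sq_integrable mul_integrable, integral_prod_mul, variance_eq_sub hX,
    integral_fun_fst (fun x => X x ^ 2)]
  simp [pow_two]

lemma integral_sub_sq_eq_two_mul_variance (hX : MemLp X 2 μ) :
    ∫ p, (X p.1 - X p.2) ^ 2 ∂μ.prod μ = 2 * Var[X; μ] := by
  have product_integrable : Integrable (fun p : Ω × Ω => X p.1 * (X p.1 - X p.2)) (μ.prod μ) :=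
    (hX.comp_fst μ).integrable_mul ((hX.comp_fst μ).sub (hX.comp_snd μ))
  have swap : ∫ p, X p.2 * (X p.2 - X p.1) ∂μ.prod μ = Var[X; μ] :=
    (integral_prod_swap fun p : Ω × Ω => X p.1 * (X p.1 - X p.2)).trans
      (integral_mul_sub_eq_variance hX)
  calc ∫ p, (X p.1 - X p.2) ^ 2 ∂μ.prod μ
      = ∫ p, (X p.1 * (X p.1 - X p.2) + X p.2 * (X p.2 - X p.1)) ∂μ.prod μ :=
        integral_congr_ae (ae_of_all _ fun p => by ring)
    _ = 2 * Var[X; μ] := by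
        rw [integral_add product_integrable (by exact product_integrable.swap), swap,
          integral_mul_sub_eq_variance hX, two_mul]

end IndependentCopies

section Lipschitz

variable {K : Type*} [Fintype K]

lemma variance_eval_stdGaussianPi (k : K) : Var[fun g : K → ℝ => g k; stdGaussianPi K] = 1 := by
  have eval := measurePreserving_eval (fun _ : K => gaussianReal 0 1) k
  have law : HasLaw (fun g : K → ℝ => g k) (gaussianReal 0 1) (stdGaussianPi K) :=
    ⟨eval.aemeasurable, eval.map_eq⟩
  simpa using law.variance_eq

variable [DecidableEq K] {f : (K → ℝ) → ℝ} {L : K → ℝ}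

theorem integral_mul_sub_exchange_le_sum_sq (hf : MemLp f 2 (stdGaussianPi K))
    (hL : ∀ i x y, |f (Function.update x i y) - f x| ≤ L i * |y - x i|) (s : Finset K) :
    ∫ p, f p.1 * (f p.1 - f (exchange s p).1) ∂twoCopies (fun _ : K => gaussianReal 0 1)
      ≤ ∑ i ∈ s, L i ^ 2 := by
  refine (integral_mul_sub_exchange_le hf s).trans (Finset.sum_le_sum fun i _ => ?_)
  have eval_memLp : MemLp (fun g : K → ℝ => g i) 2 (stdGaussianPi K) :=
    memLp_eval_stdGaussianPi i 2
  have lipschitz (p : (K → ℝ) × (K → ℝ)) :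
      (f p.1 - f (Function.update p.1 i (p.2 i))) ^ 2 ≤ L i ^ 2 * (p.1 i - p.2 i) ^ 2 := by
    rw [← mul_pow, sq_le_sq, abs_mul, abs_sub_comm, abs_sub_comm (p.1 i)]
    exact (hL i p.1 (p.2 i)).trans (by gcongr; exact le_abs_self _)
  calc (∫ p, (f p.1 - f (Function.update p.1 i (p.2 i))) ^ 2
          ∂twoCopies fun _ : K => gaussianReal 0 1) / 2
      ≤ (∫ p, L i ^ 2 * (p.1 i - p.2 i) ^ 2 ∂twoCopies fun _ : K => gaussianReal 0 1) / 2 := by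
        refine div_le_div_of_nonneg_right (integral_mono ?_ ?_ lipschitz) zero_le_two
        · exact ((memLp_fst hf).sub (memLp_update hf i)).integrable_sq
        · exact ((eval_memLp.comp_fst _).sub (eval_memLp.comp_snd _)).integrable_sq.const_mul _
    _ = L i ^ 2 := by
        rw [integral_const_mul, integral_sub_sq_eq_two_mul_variance eval_memLp,
          variance_eval_stdGaussianPi]
        ring

theorem variance_le_sum_sq (hf : MemLp f 2 (stdGaussianPi K))
    (hL : ∀ i x y, |f (Function.update x i y) - f x| ≤ L i * |y - x i|) :
    Var[f; stdGaussianPi K] ≤ ∑ i, L i ^ 2 := by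
  rw [← integral_mul_sub_eq_variance hf]
  simpa only [exchange_univ, Prod.fst_swap] using
    integral_mul_sub_exchange_le_sum_sq hf hL Finset.univ

lemma measurePreserving_piecewise_neg (s : Finset K) :
    MeasurePreserving (fun g : K → ℝ => s.piecewise (-g) g) (stdGaussianPi K)
      (stdGaussianPi K) := by
  have coordinate (i : K) : MeasurePreserving (fun x : ℝ => if i ∈ s then -x else x)
      (gaussianReal 0 1) (gaussianReal 0 1) := by
    split_ifs
    · exact ⟨measurable_neg, by simpa using gaussianReal_map_neg (μ := 0) (v := 1)⟩
    · exact MeasurePreserving.id _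
  exact measurePreserving_pi _ _ coordinate

theorem integral_sq_le_sum_sq_of_odd (hf : MemLp f 2 (stdGaussianPi K))
    (hL : ∀ i x y, |f (Function.update x i y) - f x| ≤ L i * |y - x i|) {s : Finset K}
    (hodd : ∀ x, f (s.piecewise (-x) x) = -f x) :
    ∫ g, f g ^ 2 ∂stdGaussianPi K ≤ ∑ i ∈ s, L i ^ 2 := by
  set P := twoCopies fun _ : K => gaussianReal 0 1
  set flip : (K → ℝ) × (K → ℝ) → (K → ℝ) × (K → ℝ) := Prod.map (fun g => s.piecewise (-g) g) id
    with hflip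
  have flip_preserving : MeasurePreserving flip P P :=
    (measurePreserving_piecewise_neg s).prod (MeasurePreserving.id _)
  have flip_involutive : Function.Involutive flip := fun p => by
    refine Prod.ext (funext fun i => ?_) rfl
    by_cases hi : i ∈ s <;> simp [hflip, hi]
  have exchange_flip (p) : (exchange s (flip p)).1 = (exchange s p).1 := by
    funext i
    by_cases hi : i ∈ s <;> simp [exchange, hflip, hi]
  have odd_flip (p) : f (flip p).1 = -f p.1 := hodd p.1
  have cross : ∫ p, f p.1 * f (exchange s p).1 ∂P = 0 := by
    have invariant := flip_preserving.integral_comp (MeasurableEquiv.ofInvolutive _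
      flip_involutive flip_preserving.measurable).measurableEmbedding
      fun p => f p.1 * f (exchange s p).1
    simp only [exchange_flip, odd_flip, neg_mul, integral_neg] at invariant
    linarith
  calc ∫ g, f g ^ 2 ∂stdGaussianPi K
      = ∫ p, f p.1 ^ 2 ∂P := by simp [P, integral_fun_fst (fun g => f g ^ 2)]
    _ = ∫ p, f p.1 * (f p.1 - f (exchange s p).1) ∂P := by
        simp_rw [mul_sub, ← pow_two]
        rw [integral_sub (memLp_fst hf).integrable_sq (by
          exact (memLp_fst hf).integrable_mul (memLp_exchange_fst hf s)), cross, sub_zero]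
    _ ≤ ∑ i ∈ s, L i ^ 2 := integral_mul_sub_exchange_le_sum_sq hf hL s

end Lipschitz

/-! ### Gibbs averages -/

section Gibbs

variable {S : Type*} [Fintype S]

/-- Gibbs weight of `σ` for the energy `E` on an arbitrary finite state space; on spin
configurations it is `boltzmann`. -/
def gibbsWeight (β : ℝ) (E : S → ℝ) (σ : S) : ℝ :=
  Real.exp (-β * E σ) / ∑ τ, Real.exp (-β * E τ)

/-- Gibbs average of the observable `f` for the energy `E`. -/
def gibbsAvg (β : ℝ) (E f : S → ℝ) : ℝ := ∑ σ, gibbsWeight β E σ * f σ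

/-- Covariance of two observables under the Gibbs measure of the energy `E`. -/
def gibbsCov (β : ℝ) (E f h : S → ℝ) : ℝ :=
  gibbsAvg β E (fun σ => f σ * h σ) - gibbsAvg β E f * gibbsAvg β E h

/-- Logarithm of the partition function. -/
def logPartition (β : ℝ) (E : S → ℝ) : ℝ := Real.log (∑ τ, Real.exp (-β * E τ))

variable {β : ℝ} {E f h : S → ℝ}

lemma gibbsWeight_nonneg (σ : S) : 0 ≤ gibbsWeight β E σ := by
  unfold gibbsWeight; positivity

lemma gibbsAvg_add : gibbsAvg β E (fun σ => f σ + h σ) = gibbsAvg β E f + gibbsAvg β E h := by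
  simp only [gibbsAvg, mul_add, Finset.sum_add_distrib]

lemma gibbsAvg_sub : gibbsAvg β E (fun σ => f σ - h σ) = gibbsAvg β E f - gibbsAvg β E h := by
  simp only [gibbsAvg, mul_sub, Finset.sum_sub_distrib]

lemma gibbsAvg_mul_const (c : ℝ) : gibbsAvg β E (fun σ => f σ * c) = gibbsAvg β E f * c := by
  simp only [gibbsAvg, Finset.sum_mul, mul_assoc]

lemma gibbsAvg_const_mul (c : ℝ) : gibbsAvg β E (fun σ => c * f σ) = c * gibbsAvg β E f := by
  simp only [mul_comm c, gibbsAvg_mul_const]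

lemma gibbsAvg_comm {S' : Type*} [Fintype S'] {E' : S' → ℝ} {F : S → S' → ℝ} :
    gibbsAvg β E (fun σ => gibbsAvg β E' fun τ => F σ τ)
      = gibbsAvg β E' (fun τ => gibbsAvg β E fun σ => F σ τ) := by
  simp only [gibbsAvg, Finset.mul_sum]
  rw [Finset.sum_comm]
  simp only [mul_left_comm]

lemma gibbsAvg_mono (hfh : ∀ σ, f σ ≤ h σ) : gibbsAvg β E f ≤ gibbsAvg β E h :=
  Finset.sum_le_sum fun σ _ => mul_le_mul_of_nonneg_left (hfh σ) (gibbsWeight_nonneg σ)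

lemma abs_gibbsAvg_le_gibbsAvg_abs : |gibbsAvg β E f| ≤ gibbsAvg β E (fun σ => |f σ|) := by
  refine (Finset.abs_sum_le_sum_abs _ _).trans_eq (Finset.sum_congr rfl fun σ _ => ?_)
  rw [abs_mul, abs_of_nonneg (gibbsWeight_nonneg σ)]

lemma gibbsCov_comm : gibbsCov β E f h = gibbsCov β E h f := by
  simp only [gibbsCov, mul_comm]

lemma gibbsCov_const_mul_right (c : ℝ) :
    gibbsCov β E f (fun σ => c * h σ) = c * gibbsCov β E f h := by
  simp only [gibbsCov, mul_left_comm _ c, gibbsAvg_const_mul, mul_sub]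

lemma gibbsCov_add_right {h' : S → ℝ} :
    gibbsCov β E f (fun σ => h σ + h' σ) = gibbsCov β E f h + gibbsCov β E f h' := by
  simp only [gibbsCov, mul_add, gibbsAvg_add]
  ring

lemma gibbsCov_eq_gibbsAvg_mul_sub :
    gibbsCov β E f h = gibbsAvg β E fun σ => f σ * (h σ - gibbsAvg β E h) := by
  simp only [gibbsCov, mul_sub, gibbsAvg_sub, gibbsAvg_mul_const]

lemma gibbsAvg_gibbsCov {S' : Type*} [Fintype S'] {E' f' : S' → ℝ} {F : S → S' → ℝ} :
    gibbsAvg β E (fun σ => gibbsCov β E' f' (F σ))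
      = gibbsCov β E' f' fun τ => gibbsAvg β E fun σ => F σ τ := by
  simp only [gibbsCov, gibbsAvg_sub, gibbsAvg_const_mul]
  rw [gibbsAvg_comm, gibbsAvg_comm (F := F)]
  simp only [gibbsAvg_const_mul]

lemma hasDerivAt_partition {E : ℝ → S → ℝ} {E' : S → ℝ} {t : ℝ}
    (hE : ∀ σ, HasDerivAt (fun r => E r σ) (E' σ) t) :
    HasDerivAt (fun r => ∑ τ, Real.exp (-β * E r τ))
      (-β * ∑ τ, Real.exp (-β * E t τ) * E' τ) t := by
  refine (HasDerivAt.fun_sum fun σ _ => ((hE σ).const_mul (-β)).exp).congr_deriv ?_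
  rw [Finset.mul_sum]
  exact Finset.sum_congr rfl fun _ _ => by ring

variable [Nonempty S]

lemma partition_pos (β : ℝ) (E : S → ℝ) : 0 < ∑ τ, Real.exp (-β * E τ) :=
  Finset.sum_pos (fun _ _ => Real.exp_pos _) Finset.univ_nonempty

lemma sum_gibbsWeight : ∑ σ, gibbsWeight β E σ = 1 := by
  simp only [gibbsWeight, ← Finset.sum_div]
  exact div_self (partition_pos β E).ne'

lemma gibbsWeight_le_one (σ : S) : gibbsWeight β E σ ≤ 1 := by
  rw [← sum_gibbsWeight (β := β) (E := E)]
  exact Finset.single_le_sum (fun τ _ => gibbsWeight_nonneg τ) (Finset.mem_univ σ)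

lemma gibbsAvg_const (c : ℝ) : gibbsAvg β E (fun _ => c) = c := by
  rw [gibbsAvg, ← Finset.sum_mul, sum_gibbsWeight, one_mul]

lemma abs_gibbsAvg_le {C : ℝ} (hf : ∀ σ, |f σ| ≤ C) : |gibbsAvg β E f| ≤ C :=
  abs_gibbsAvg_le_gibbsAvg_abs.trans ((gibbsAvg_mono hf).trans_eq (gibbsAvg_const C))

lemma gibbsCov_self_eq_gibbsAvg_sub_sq :
    gibbsCov β E f f = gibbsAvg β E fun σ => (f σ - gibbsAvg β E f) ^ 2 := by
  set m := gibbsAvg β E f with hm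
  have expand : (fun σ => (f σ - m) ^ 2) = fun σ => f σ * f σ - f σ * (2 * m) + m ^ 2 := by
    funext σ; ring
  rw [expand, gibbsAvg_add, gibbsAvg_sub, gibbsAvg_mul_const, gibbsAvg_const, gibbsCov, ← hm]
  ring

lemma abs_gibbsCov_le {M δ : ℝ} (hδ : 0 < δ) (hM : ∀ σ, |h σ| ≤ M) :
    |gibbsCov β E f h| ≤ M * (δ / 2 + gibbsCov β E f f / (2 * δ)) := by
  rw [gibbsCov_comm, gibbsCov_eq_gibbsAvg_mul_sub, gibbsCov_self_eq_gibbsAvg_sub_sq]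
  set m := gibbsAvg β E f
  have pointwise (σ : S) : |h σ * (f σ - m)| ≤ M * (δ / 2) + M / (2 * δ) * (f σ - m) ^ 2 := by
    have young : |f σ - m| ≤ δ / 2 + (f σ - m) ^ 2 / (2 * δ) := by
      rw [← sq_abs (f σ - m), ← sub_nonneg]
      have square : δ / 2 + |f σ - m| ^ 2 / (2 * δ) - |f σ - m|
          = (|f σ - m| - δ) ^ 2 / (2 * δ) := by
        field_simp; ring
      rw [square]
      positivity
    calc |h σ * (f σ - m)| = |h σ| * |f σ - m| := abs_mul _ _
      _ ≤ M * (δ / 2 + (f σ - m) ^ 2 / (2 * δ)) :=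
          mul_le_mul (hM σ) young (abs_nonneg _) ((abs_nonneg _).trans (hM σ))
      _ = _ := by ring
  refine (abs_gibbsAvg_le_gibbsAvg_abs.trans (gibbsAvg_mono pointwise)).trans_eq ?_
  rw [gibbsAvg_add, gibbsAvg_const, gibbsAvg_const_mul]
  ring

lemma logPartition_sub_le {E E' : S → ℝ} {δ : ℝ} (hE : ∀ σ, |E σ - E' σ| ≤ δ) :
    logPartition β E - logPartition β E' ≤ |β| * δ := by
  have weight_le (σ : S) : Real.exp (-β * E σ) ≤ Real.exp (-β * E' σ) * Real.exp (|β| * δ) := by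
    rw [← Real.exp_add, Real.exp_le_exp]
    have := (neg_le_abs _).trans
      ((abs_mul β _).trans_le (mul_le_mul_of_nonneg_left (hE σ) (abs_nonneg β)))
    linarith
  rw [sub_le_iff_le_add', logPartition, logPartition, ← Real.log_exp (|β| * δ),
    ← Real.log_mul (partition_pos β E').ne' (Real.exp_pos _).ne', Finset.sum_mul]
  exact Real.log_le_log (partition_pos β E) (Finset.sum_le_sum fun σ _ => weight_le σ)

lemma abs_logPartition_sub_le {E E' : S → ℝ} {δ : ℝ} (hE : ∀ σ, |E σ - E' σ| ≤ δ) :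
    |logPartition β E - logPartition β E'| ≤ |β| * δ :=
  abs_sub_le_iff.2 ⟨logPartition_sub_le hE,
    logPartition_sub_le fun σ => (abs_sub_comm _ _).trans_le (hE σ)⟩

section Deriv

variable {E : ℝ → S → ℝ} {E' : S → ℝ} {t : ℝ}

lemma sum_exp_mul_eq_gibbsAvg_mul (E f : S → ℝ) :
    ∑ τ, Real.exp (-β * E τ) * f τ = gibbsAvg β E f * ∑ τ, Real.exp (-β * E τ) := by
  have := (partition_pos β E).ne'
  rw [gibbsAvg, Finset.sum_mul]
  refine Finset.sum_congr rfl fun σ _ => ?_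
  rw [gibbsWeight]
  field_simp

lemma hasDerivAt_logPartition (hE : ∀ σ, HasDerivAt (fun r => E r σ) (E' σ) t) :
    HasDerivAt (fun r => logPartition β (E r)) (-β * gibbsAvg β (E t) E') t := by
  have hZ := (partition_pos β (E t)).ne'
  refine ((hasDerivAt_partition hE).log hZ).congr_deriv ?_
  rw [sum_exp_mul_eq_gibbsAvg_mul]
  field_simp

lemma hasDerivAt_gibbsWeight (hE : ∀ σ, HasDerivAt (fun r => E r σ) (E' σ) t) (σ : S) :
    HasDerivAt (fun r => gibbsWeight β (E r) σ)
      (-β * (gibbsWeight β (E t) σ * (E' σ - gibbsAvg β (E t) E'))) t := by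
  have hZ := (partition_pos β (E t)).ne'
  refine ((((hE σ).const_mul (-β)).exp).div (hasDerivAt_partition hE) hZ).congr_deriv ?_
  rw [sum_exp_mul_eq_gibbsAvg_mul, gibbsWeight]
  field_simp
  ring

lemma hasDerivAt_gibbsAvg {f : ℝ → S → ℝ} {f' : S → ℝ}
    (hE : ∀ σ, HasDerivAt (fun r => E r σ) (E' σ) t)
    (hf : ∀ σ, HasDerivAt (fun r => f r σ) (f' σ) t) :
    HasDerivAt (fun r => gibbsAvg β (E r) (f r))
      (gibbsAvg β (E t) f' - β * gibbsCov β (E t) (f t) E') t := by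
  refine (HasDerivAt.fun_sum fun σ _ =>
    (hasDerivAt_gibbsWeight hE σ).mul (hf σ)).congr_deriv ?_
  rw [gibbsCov_eq_gibbsAvg_mul_sub, ← gibbsAvg_const_mul, ← gibbsAvg_sub]
  exact Finset.sum_congr rfl fun σ _ => by ring

end Deriv

section Growth

variable {T K : Type*} [TopologicalSpace T] [Fintype K] {E f h : T → (K → ℝ) → S → ℝ}

lemma polyGrowth_gibbsWeight (hE : ∀ σ, Continuous fun p : T × (K → ℝ) => E p.1 p.2 σ) (σ : S) :
    PolyGrowth fun t g => gibbsWeight β (E t g) σ := by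
  refine PolyGrowth.of_bounded (C := 1) ?_ fun t g => ?_
  · exact (Real.continuous_exp.comp ((hE σ).const_mul _)).div
      (continuous_finsetSum _ fun τ _ => Real.continuous_exp.comp ((hE τ).const_mul _))
      fun p => (partition_pos β (E p.1 p.2)).ne'
  · rw [abs_of_nonneg (gibbsWeight_nonneg σ)]
    exact gibbsWeight_le_one σ

lemma polyGrowth_gibbsAvg (hE : ∀ σ, Continuous fun p : T × (K → ℝ) => E p.1 p.2 σ)
    (hf : ∀ σ, PolyGrowth fun t g => f t g σ) :
    PolyGrowth fun t g => gibbsAvg β (E t g) (f t g) :=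
  PolyGrowth.sum fun σ _ => (polyGrowth_gibbsWeight hE σ).mul (hf σ)

lemma polyGrowth_gibbsCov (hE : ∀ σ, Continuous fun p : T × (K → ℝ) => E p.1 p.2 σ)
    (hf : ∀ σ, PolyGrowth fun t g => f t g σ) (hh : ∀ σ, PolyGrowth fun t g => h t g σ) :
    PolyGrowth fun t g => gibbsCov β (E t g) (f t g) (h t g) :=
  (polyGrowth_gibbsAvg hE fun σ => (hf σ).mul (hh σ)).sub
    ((polyGrowth_gibbsAvg hE hf).mul (polyGrowth_gibbsAvg hE hh))

end Growth

end Gibbs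

/-! ### Integrals over a pair of angles -/

/-- The integral of `f` over the square `[0, π] × [0, π]`. -/
def angleIntegral (f : ℝ → ℝ → ℝ) : ℝ :=
  ∫ t in (0 : ℝ)..Real.pi, ∫ s in (0 : ℝ)..Real.pi, f t s

section AngleIntegral

variable {f h : ℝ → ℝ → ℝ}

lemma continuous_intervalIntegral_right (hf : Continuous fun p : ℝ × ℝ => f p.1 p.2) (a b : ℝ) :
    Continuous fun t => ∫ s in a..b, f t s :=
  intervalIntegral.continuous_parametric_intervalIntegral_of_continuous' hf a b

lemma angleIntegral_add (hf : Continuous fun p : ℝ × ℝ => f p.1 p.2)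
    (hh : Continuous fun p : ℝ × ℝ => h p.1 p.2) :
    angleIntegral (fun t s => f t s + h t s) = angleIntegral f + angleIntegral h := by
  have inner (t : ℝ) : ∫ s in (0 : ℝ)..Real.pi, (f t s + h t s)
      = (∫ s in (0 : ℝ)..Real.pi, f t s) + ∫ s in (0 : ℝ)..Real.pi, h t s :=
    intervalIntegral.integral_add
      (Continuous.intervalIntegrable (hf.comp (Continuous.prodMk_right t)) _ _)
      (Continuous.intervalIntegrable (hh.comp (Continuous.prodMk_right t)) _ _)
  simp only [angleIntegral, inner]
  exact intervalIntegral.integral_add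
    ((continuous_intervalIntegral_right hf _ _).intervalIntegrable _ _)
    ((continuous_intervalIntegral_right hh _ _).intervalIntegrable _ _)

lemma angleIntegral_const_mul (c : ℝ) :
    angleIntegral (fun t s => c * f t s) = c * angleIntegral f := by
  simp only [angleIntegral, intervalIntegral.integral_const_mul]

lemma angleIntegral_sub (hf : Continuous fun p : ℝ × ℝ => f p.1 p.2)
    (hh : Continuous fun p : ℝ × ℝ => h p.1 p.2) :
    angleIntegral (fun t s => f t s - h t s) = angleIntegral f - angleIntegral h := by
  have sum := angleIntegral_add hf (h := fun t s => -1 * h t s) (hh.const_mul (-1))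
  rw [angleIntegral_const_mul] at sum
  simpa only [neg_one_mul, ← sub_eq_add_neg] using sum

lemma angleIntegral_swap (hf : Continuous fun p : ℝ × ℝ => f p.1 p.2) :
    angleIntegral (fun t s => f s t) = angleIntegral f := by
  refine intervalIntegral_intervalIntegral_swap ?_
  have on_square : IntegrableOn (fun p : ℝ × ℝ => f p.2 p.1)
      (Set.uIcc 0 Real.pi ×ˢ Set.uIcc 0 Real.pi) :=
    (hf.comp continuous_swap).continuousOn.integrableOn_compact
      (isCompact_uIcc.prod isCompact_uIcc)
  exact on_square.mono_set (Set.prod_mono Set.uIoc_subset_uIcc Set.uIoc_subset_uIcc)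

lemma angleIntegral_eq_of_add_swap_eq (hf : Continuous fun p : ℝ × ℝ => f p.1 p.2)
    (hh : Continuous fun p : ℝ × ℝ => h p.1 p.2)
    (hfh : ∀ t s, f t s + f s t = h t s + h s t) : angleIntegral f = angleIntegral h := by
  have symmetrize {k : ℝ → ℝ → ℝ} (hk : Continuous fun p : ℝ × ℝ => k p.1 p.2) :
      2 * angleIntegral k = angleIntegral fun t s => k t s + k s t := by
    rw [angleIntegral_add hk (h := fun t s => k s t) (hk.comp continuous_swap),
      angleIntegral_swap hk, two_mul]
  have doubled : 2 * angleIntegral f = 2 * angleIntegral h := by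
    simp only [symmetrize hf, symmetrize hh, hfh]
  exact mul_left_cancel₀ two_ne_zero doubled

lemma abs_angleIntegral_le {ψ : ℝ → ℝ} (hψ : Continuous ψ)
    (hf : Continuous fun p : ℝ × ℝ => f p.1 p.2) (hfψ : ∀ t s, |f t s| ≤ ψ t) :
    |angleIntegral f| ≤ Real.pi * ∫ t in (0 : ℝ)..Real.pi, ψ t := by
  have inner (t : ℝ) : |∫ s in (0 : ℝ)..Real.pi, f t s| ≤ Real.pi * ψ t := by
    have bound := intervalIntegral.norm_integral_le_of_norm_le_const (a := 0) (b := Real.pi)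
      (f := f t) fun s _ => hfψ t s
    rwa [Real.norm_eq_abs, sub_zero, abs_of_nonneg Real.pi_pos.le, mul_comm] at bound
  rw [← intervalIntegral.integral_const_mul]
  exact (intervalIntegral.abs_integral_le_integral_abs Real.pi_pos.le).trans
    (intervalIntegral.integral_mono_on Real.pi_pos.le
      ((continuous_intervalIntegral_right hf _ _).abs.intervalIntegrable _ _)
      ((hψ.const_mul _).intervalIntegrable _ _) fun t _ => inner t)

end AngleIntegral

namespace PolyGrowth

variable {K : Type*} [Fintype K] {Φ : ℝ → (K → ℝ) → ℝ}

lemma intervalIntegral (hΦ : PolyGrowth Φ) (a b : ℝ) :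
    PolyGrowth fun (_ : Unit) g => ∫ t in a..b, Φ t g := by
  obtain ⟨hc, C, hC, n, hn⟩ := hΦ
  obtain ⟨C', hC'⟩ := (isCompact_uIcc (a := a) (b := b)).bddAbove_image hC.continuousOn
  refine ⟨?_, fun _ => C' * |b - a|, continuous_const, n, fun _ g => ?_⟩
  · refine intervalIntegral.continuous_parametric_intervalIntegral_of_continuous'
      (f := fun (p : Unit × (K → ℝ)) t => Φ t p.2) ?_ a b
    exact hc.comp (by fun_prop : Continuous fun q : (Unit × (K → ℝ)) × ℝ => (q.2, q.1.2))
  · have bound (t : ℝ) (ht : t ∈ Set.uIoc a b) : ‖Φ t g‖ ≤ C' * (1 + ‖g‖) ^ n := by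
      refine (hn t g).trans ?_
      gcongr
      exact hC' (Set.mem_image_of_mem C (Set.uIoc_subset_uIcc ht))
    rw [mul_right_comm]
    exact intervalIntegral.norm_integral_le_of_norm_le_const bound

lemma integral_sq_intervalIntegral (hΦ : PolyGrowth Φ) :
    ∫ g, (∫ t in (0 : ℝ)..Real.pi, Φ t g) ^ 2 ∂stdGaussianPi K
      = angleIntegral fun t s => ∫ g, Φ t g * Φ s g ∂stdGaussianPi K := by
  have h_inner : PolyGrowth fun (_ : ℝ) g => ∫ s in (0 : ℝ)..Real.pi, Φ s g :=
    (hΦ.intervalIntegral 0 Real.pi).comp (φ := fun _ => ()) continuous_const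
  have h_prod (t : ℝ) : PolyGrowth fun s g => Φ t g * Φ s g := (hΦ.comp continuous_const).mul hΦ
  simp only [angleIntegral, (h_prod _).intervalIntegral_integral_swap,
    intervalIntegral.integral_const_mul, (hΦ.mul h_inner).intervalIntegral_integral_swap,
    intervalIntegral.integral_mul_const, pow_two]

lemma sq_integral_intervalIntegral (hΦ : PolyGrowth Φ) :
    (∫ g, (∫ t in (0 : ℝ)..Real.pi, Φ t g) ∂stdGaussianPi K) ^ 2
      = angleIntegral fun t s =>
        (∫ g, Φ t g ∂stdGaussianPi K) * ∫ g, Φ s g ∂stdGaussianPi K := by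
  simp only [angleIntegral, intervalIntegral.integral_const_mul,
    intervalIntegral.integral_mul_const, hΦ.intervalIntegral_integral_swap, pow_two]

end PolyGrowth

/-! ### Rotation of a part of the disorder -/

lemma hasDerivAt_sum_mul_line {K : Type*} [Fintype K] (a g u : K → ℝ) :
    HasDerivAt (fun r : ℝ => ∑ k, a k * (g + r • u) k) (∑ k, u k * a k) 0 := by
  refine HasDerivAt.fun_sum fun k _ => ?_
  have line : HasDerivAt (fun r : ℝ => (g + r • u) k) (u k) 0 := by
    simpa using ((hasDerivAt_id (0 : ℝ)).mul_const (u k)).const_add (g k)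
  exact (line.const_mul (a k)).congr_deriv (mul_comm _ _)

/-- A Gibbs system on the state space `S` whose energy is linear in independent standard Gaussian
couplings `(x, y) ∈ ℝ^κ × ℝ^κ`: the couplings `x_k` with `k ∈ region` are rotated into
`cos t x_k + sin t y_k`, and the deterministic energy is `θ t * bulk + rest`. -/
structure FlipModel (κ S : Type*) where
  /-- inverse temperature -/
  β : ℝ
  /-- energy carried by each coupling -/
  coeff : κ → S → ℝ
  /-- couplings that are rotated -/
  region : Finset κ
  /-- deterministic energy modulated by the angle -/
  bulk : S → ℝ
  /-- deterministic energy independent of the angle -/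
  rest : S → ℝ
  /-- modulation of the bulk energy -/
  θ : ℝ → ℝ
  contDiff_θ : ContDiff ℝ 1 θ

namespace FlipModel

variable {κ S : Type*} (M : FlipModel κ S)

/-- Covariance of the rotated part of the energy. -/
def C (σ τ : S) : ℝ := ∑ X ∈ M.region, M.coeff X σ * M.coeff X τ

lemma C_comm (σ τ : S) : M.C σ τ = M.C τ σ :=
  Finset.sum_congr rfl fun _ _ => mul_comm _ _

lemma abs_C_le {A : κ → ℝ} (hA : ∀ X σ, |M.coeff X σ| ≤ A X) (σ τ : S) :
    |M.C σ τ| ≤ ∑ X ∈ M.region, A X ^ 2 := by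
  refine (Finset.abs_sum_le_sum_abs _ _).trans (Finset.sum_le_sum fun X _ => ?_)
  rw [abs_mul, pow_two]
  exact mul_le_mul (hA X σ) (hA X τ) (abs_nonneg _) ((abs_nonneg _).trans (hA X σ))

lemma hasDerivAt_θ (t : ℝ) : HasDerivAt M.θ (deriv M.θ t) t :=
  (M.contDiff_θ.differentiable one_ne_zero t).hasDerivAt

lemma continuous_deriv_θ : Continuous (deriv M.θ) := M.contDiff_θ.continuous_deriv le_rfl

section Energy

variable [DecidableEq κ]

/-- Coefficients of the couplings in the energy at angle `t`. -/
def dir (t : ℝ) (σ : S) : κ ⊕ κ → ℝ :=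
  Sum.elim (fun X => if X ∈ M.region then Real.cos t * M.coeff X σ else M.coeff X σ)
    (fun X => if X ∈ M.region then Real.sin t * M.coeff X σ else 0)

/-- Derivative of `dir` in the angle. -/
def dirDeriv (t : ℝ) (σ : S) : κ ⊕ κ → ℝ :=
  Sum.elim (fun X => if X ∈ M.region then -Real.sin t * M.coeff X σ else 0)
    (fun X => if X ∈ M.region then Real.cos t * M.coeff X σ else 0)

lemma hasDerivAt_dir (t : ℝ) (σ : S) (k : κ ⊕ κ) :
    HasDerivAt (fun r => M.dir r σ k) (M.dirDeriv t σ k) t := by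
  rcases k with X | X <;> by_cases h : X ∈ M.region <;>
    simp only [dir, dirDeriv, Sum.elim_inl, Sum.elim_inr, h, if_true, if_false]
  · exact (Real.hasDerivAt_cos t).mul_const _
  · exact hasDerivAt_const _ _
  · exact (Real.hasDerivAt_sin t).mul_const _
  · exact hasDerivAt_const _ _

lemma continuous_dir (σ : S) (k : κ ⊕ κ) : Continuous fun t => M.dir t σ k :=
  continuous_iff_continuousAt.2 fun t => (M.hasDerivAt_dir t σ k).continuousAt

lemma continuous_dirDeriv (σ : S) (k : κ ⊕ κ) : Continuous fun t => M.dirDeriv t σ k := by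
  rcases k with X | X <;> by_cases h : X ∈ M.region <;>
    simp only [dirDeriv, Sum.elim_inl, Sum.elim_inr, h, if_true, if_false] <;> fun_prop

lemma abs_dir_le {A : κ → ℝ} (hA : ∀ X σ, |M.coeff X σ| ≤ A X) {t : ℝ} (ht : Real.sin t = 0)
    (σ : S) (k : κ ⊕ κ) : |M.dir t σ k| ≤ (Sum.elim A 0 k : ℝ) := by
  rcases k with X | X
  · simp only [dir, Sum.elim_inl]
    split_ifs
    · rw [abs_mul]
      exact (mul_le_of_le_one_left (abs_nonneg _) (Real.abs_cos_le_one t)).trans (hA X σ)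
    · exact hA X σ
  · simp [dir, ht]

variable [Fintype κ]

lemma sum_dirDeriv_mul_dir (s t : ℝ) (τ σ : S) :
    ∑ k, M.dirDeriv s τ k * M.dir t σ k = Real.sin (t - s) * M.C τ σ := by
  simp only [dir, dirDeriv, Fintype.sum_sum_type, Sum.elim_inl, Sum.elim_inr, C, Real.sin_sub,
    ← Finset.sum_add_distrib, Finset.mul_sum]
  rw [← Finset.sum_subset (Finset.subset_univ M.region) fun X _ hX => by simp [hX]]
  refine Finset.sum_congr rfl fun X hX => ?_
  simp only [hX, if_true]
  ring

lemma sum_dirDeriv_mul_dirDeriv (s t : ℝ) (τ σ : S) :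
    ∑ k, M.dirDeriv s τ k * M.dirDeriv t σ k = Real.cos (t - s) * M.C τ σ := by
  simp only [dirDeriv, Fintype.sum_sum_type, Sum.elim_inl, Sum.elim_inr, C, Real.cos_sub,
    ← Finset.sum_add_distrib, Finset.mul_sum]
  rw [← Finset.sum_subset (Finset.subset_univ M.region) fun X _ hX => by simp [hX]]
  refine Finset.sum_congr rfl fun X hX => ?_
  simp only [hX, if_true]
  ring

/-- Energy at angle `t`. -/
def energy (t : ℝ) (g : κ ⊕ κ → ℝ) (σ : S) : ℝ :=
  ∑ k, M.dir t σ k * g k + M.θ t * M.bulk σ + M.rest σ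

lemma energy_update_sub (t : ℝ) (g : κ ⊕ κ → ℝ) (k : κ ⊕ κ) (y : ℝ) (σ : S) :
    M.energy t (Function.update g k y) σ - M.energy t g σ = M.dir t σ k * (y - g k) := by
  simp only [energy, add_sub_add_right_eq_sub, ← Finset.sum_sub_distrib, ← mul_sub]
  rw [Finset.sum_eq_single k (fun j _ hj => by simp [hj]) (by simp), Function.update_self]

lemma energy_pi_eq (hθ : M.θ Real.pi = M.θ 0) (g : κ ⊕ κ → ℝ) :
    M.energy Real.pi g
      = M.energy 0 ((M.region.map Function.Embedding.inl).piecewise (-g) g) := by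
  funext σ
  simp only [energy, dir, Fintype.sum_sum_type, Sum.elim_inl, Sum.elim_inr, Real.cos_pi,
    Real.sin_pi, Real.cos_zero, Real.sin_zero, hθ]
  congr 3
  · refine Finset.sum_congr rfl fun X _ => ?_
    by_cases hX : X ∈ M.region <;> simp [Finset.piecewise, hX]
  · simp

/-- Part of the angular derivative of the energy that is linear in the couplings. -/
def force (t : ℝ) (g : κ ⊕ κ → ℝ) (σ : S) : ℝ := ∑ k, M.dirDeriv t σ k * g k

lemma hasDerivAt_energy (t : ℝ) (g : κ ⊕ κ → ℝ) (σ : S) :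
    HasDerivAt (fun r => M.energy r g σ) (M.force t g σ + deriv M.θ t * M.bulk σ) t :=
  ((HasDerivAt.fun_sum fun k _ => (M.hasDerivAt_dir t σ k).mul_const (g k)).add
    ((M.hasDerivAt_θ t).mul_const _)).add_const _

lemma hasLineDerivAt_energy (s t : ℝ) (g : κ ⊕ κ → ℝ) (τ σ : S) :
    HasLineDerivAt ℝ (fun g => M.energy t g σ) (Real.sin (t - s) * M.C τ σ) g
      (M.dirDeriv s τ) :=
  (((hasDerivAt_sum_mul_line (M.dir t σ) g _).add_const _).add_const _).congr_deriv
    (M.sum_dirDeriv_mul_dir s t τ σ)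

lemma hasLineDerivAt_force (s t : ℝ) (g : κ ⊕ κ → ℝ) (τ σ : S) :
    HasLineDerivAt ℝ (fun g => M.force t g σ) (Real.cos (t - s) * M.C τ σ) g
      (M.dirDeriv s τ) :=
  (hasDerivAt_sum_mul_line (M.dirDeriv t σ) g _).congr_deriv (M.sum_dirDeriv_mul_dirDeriv s t τ σ)

lemma continuous_energy {T : Type*} [TopologicalSpace T] {φ : T → ℝ} (hφ : Continuous φ) (σ : S) :
    Continuous fun p : T × (κ ⊕ κ → ℝ) => M.energy (φ p.1) p.2 σ := by
  have hθ := M.contDiff_θ.continuous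
  have hdir := M.continuous_dir σ
  unfold energy
  fun_prop

lemma polyGrowth_force (σ : S) : PolyGrowth fun t g => M.force t g σ :=
  PolyGrowth.sum fun k _ => (PolyGrowth.of_param (M.continuous_dirDeriv σ k)).mul
    (PolyGrowth.coord k)

end Energy

variable [DecidableEq κ] [Fintype κ] [Fintype S]

/-- Gibbs average at angle `t`. -/
def av (t : ℝ) (g : κ ⊕ κ → ℝ) (f : S → ℝ) : ℝ := gibbsAvg M.β (M.energy t g) f

/-- Gibbs covariance at angle `t`. -/
def thermalCov (t : ℝ) (g : κ ⊕ κ → ℝ) (f h : S → ℝ) : ℝ := gibbsCov M.β (M.energy t g) f h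

/-- Gibbs average of the covariance of two replicas at angles `t`, `s`: `ω_{t,s}(C_{1,2})`. -/
def overlap (t s : ℝ) (g : κ ⊕ κ → ℝ) : ℝ := M.av t g fun σ => M.av s g (M.C σ)

/-- `ω_{t,s}(C_{1,2}²)`. -/
def overlapSq (t s : ℝ) (g : κ ⊕ κ → ℝ) : ℝ := M.av t g fun σ => M.av s g fun τ => M.C σ τ ^ 2

/-- `ω_{t,s,t}(C_{1,2} C_{2,3})`. -/
def overlapChain (t s : ℝ) (g : κ ⊕ κ → ℝ) : ℝ := M.av s g fun τ => M.av t g (M.C τ) ^ 2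

/-- `ω_{t,s}(B_1 C_{1,2}) - ω_{t,s,t}(B_1 C_{2,3})` for the bulk energy `B`. -/
def mixed (t s : ℝ) (g : κ ⊕ κ → ℝ) : ℝ := M.av s g fun τ => M.thermalCov t g M.bulk (M.C τ)

/-- Combination of overlaps produced by a double integration by parts; `bracket_eq` rewrites it
in terms of replicas. -/
def bracket (t s : ℝ) (g : κ ⊕ κ → ℝ) : ℝ :=
  M.av s g fun τ => M.thermalCov t g (M.C τ) (M.C τ)
    - M.av s g fun τ' => M.thermalCov t g (M.C τ') (M.C τ)

/-- Gibbs average of the angular derivative of the energy. -/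
def velocity (t : ℝ) (g : κ ⊕ κ → ℝ) : ℝ :=
  M.av t g (M.force t g) + deriv M.θ t * M.av t g M.bulk

lemma bracket_eq (t s : ℝ) (g : κ ⊕ κ → ℝ) :
    M.bracket t s g = M.overlapSq t s g - M.overlapChain t s g - M.overlapChain s t g
      + M.overlap t s g ^ 2 := by
  have C_flip (τ : S) : (fun σ => M.C σ τ) = M.C τ := funext fun σ => M.C_comm σ τ
  have square : M.overlapSq t s g = M.av s g fun τ => M.av t g fun σ => M.C τ σ * M.C τ σ := by
    simp only [overlapSq, av, pow_two]
    rw [gibbsAvg_comm]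
    refine congrArg _ (funext fun τ => congrArg _ (funext fun σ => ?_))
    rw [M.C_comm σ τ]
  have chain : M.overlapChain s t g
      = M.av s g fun τ => M.av s g fun τ' => M.av t g fun σ => M.C τ' σ * M.C τ σ := by
    simp only [overlapChain, av]
    simp only [gibbsAvg_comm (E := M.energy s g) (E' := M.energy t g), gibbsAvg_mul_const,
      gibbsAvg_const_mul, C_flip, pow_two]
  have single : M.overlap t s g = M.av s g fun τ => M.av t g (M.C τ) := by
    simp only [overlap, av]
    rw [gibbsAvg_comm]
    simp only [C_flip]
  rw [square, chain, single]
  simp only [bracket, overlapChain, thermalCov, gibbsCov, av, gibbsAvg_sub, gibbsAvg_mul_const,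
    gibbsAvg_const_mul, pow_two]
  ring

section Growth

variable [Nonempty S] {T : Type*} [TopologicalSpace T] {φ ψ : T → ℝ} {f h : T → (κ ⊕ κ → ℝ) → S → ℝ}

lemma polyGrowth_av (hφ : Continuous φ) (hf : ∀ σ, PolyGrowth fun t g => f t g σ) :
    PolyGrowth fun t g => M.av (φ t) g (f t g) :=
  polyGrowth_gibbsAvg (M.continuous_energy hφ) hf

lemma polyGrowth_av_const (hφ : Continuous φ) (f : S → ℝ) :
    PolyGrowth fun t g => M.av (φ t) g f :=
  M.polyGrowth_av hφ fun σ => PolyGrowth.const (f σ)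

lemma polyGrowth_thermalCov (hφ : Continuous φ) (hf : ∀ σ, PolyGrowth fun t g => f t g σ)
    (hh : ∀ σ, PolyGrowth fun t g => h t g σ) :
    PolyGrowth fun t g => M.thermalCov (φ t) g (f t g) (h t g) :=
  polyGrowth_gibbsCov (M.continuous_energy hφ) hf hh

lemma polyGrowth_thermalCov_const (hφ : Continuous φ) (f h : S → ℝ) :
    PolyGrowth fun t g => M.thermalCov (φ t) g f h :=
  M.polyGrowth_thermalCov hφ (fun σ => PolyGrowth.const (f σ)) fun σ => PolyGrowth.const (h σ)

lemma polyGrowth_overlap (hφ : Continuous φ) (hψ : Continuous ψ) :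
    PolyGrowth fun t g => M.overlap (φ t) (ψ t) g :=
  M.polyGrowth_av hφ fun σ => M.polyGrowth_av_const hψ (M.C σ)

lemma polyGrowth_overlapSq (hφ : Continuous φ) (hψ : Continuous ψ) :
    PolyGrowth fun t g => M.overlapSq (φ t) (ψ t) g :=
  M.polyGrowth_av hφ fun σ => M.polyGrowth_av_const hψ fun τ => M.C σ τ ^ 2

lemma polyGrowth_overlapChain (hφ : Continuous φ) (hψ : Continuous ψ) :
    PolyGrowth fun t g => M.overlapChain (φ t) (ψ t) g :=
  M.polyGrowth_av hψ fun τ => (M.polyGrowth_av_const hφ (M.C τ)).sq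

lemma polyGrowth_mixed (hφ : Continuous φ) (hψ : Continuous ψ) :
    PolyGrowth fun t g => M.mixed (φ t) (ψ t) g :=
  M.polyGrowth_av hψ fun τ => M.polyGrowth_thermalCov_const hφ M.bulk (M.C τ)

lemma polyGrowth_bracket (hφ : Continuous φ) (hψ : Continuous ψ) :
    PolyGrowth fun t g => M.bracket (φ t) (ψ t) g :=
  M.polyGrowth_av hψ fun τ => (M.polyGrowth_thermalCov_const hφ (M.C τ) (M.C τ)).sub
    (M.polyGrowth_av hψ fun τ' => M.polyGrowth_thermalCov_const hφ (M.C τ') (M.C τ))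

lemma polyGrowth_av_force (hφ : Continuous φ) :
    PolyGrowth fun t g => M.av (φ t) g (M.force (φ t) g) :=
  M.polyGrowth_av hφ fun σ => (M.polyGrowth_force σ).comp hφ

lemma polyGrowth_velocity : PolyGrowth M.velocity :=
  (M.polyGrowth_av_force continuous_id).add ((PolyGrowth.of_param M.continuous_deriv_θ).mul
    (M.polyGrowth_av_const continuous_id M.bulk))

end Growth

section IntegrationByParts

variable [Nonempty S]

lemma hasLineDerivAt_av (s t : ℝ) {f : (κ ⊕ κ → ℝ) → S → ℝ} {f' : S → ℝ} {g : κ ⊕ κ → ℝ} {τ : S}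
    (hf : ∀ σ, HasLineDerivAt ℝ (fun g => f g σ) (f' σ) g (M.dirDeriv s τ)) :
    HasLineDerivAt ℝ (fun g => M.av t g (f g))
      (M.av t g f' - M.β * Real.sin (t - s) * M.thermalCov t g (f g) (M.C τ)) g
      (M.dirDeriv s τ) := by
  have h := hasDerivAt_gibbsAvg (β := M.β) (fun σ => M.hasLineDerivAt_energy s t g τ σ) hf
  simp only [zero_smul, add_zero, gibbsCov_const_mul_right, ← mul_assoc] at h
  exact h

lemma hasLineDerivAt_av_const (s t : ℝ) (f : S → ℝ) (g : κ ⊕ κ → ℝ) (τ : S) :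
    HasLineDerivAt ℝ (fun g => M.av t g f)
      (-M.β * Real.sin (t - s) * M.thermalCov t g f (M.C τ)) g (M.dirDeriv s τ) := by
  have h := M.hasLineDerivAt_av s t (f := fun _ => f) (g := g) (τ := τ) fun σ =>
    hasDerivAt_const _ (f σ)
  rwa [av, gibbsAvg_const, zero_sub, ← neg_mul, ← neg_mul] at h

/-- Since the force at angle `t` is independent of the energy at angle `t`, integrating it by
parts does not differentiate the Gibbs weights. -/
lemma integral_av_force_mul (t : ℝ) {F F' : S → (κ ⊕ κ → ℝ) → ℝ}
    (hF : ∀ σ, PolyGrowth fun (_ : Unit) => F σ) (hF' : ∀ σ, PolyGrowth fun (_ : Unit) => F' σ)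
    (h : ∀ σ g, HasLineDerivAt ℝ (F σ) (F' σ g) g (M.dirDeriv t σ)) :
    ∫ g, M.av t g (fun σ => M.force t g σ * F σ g) ∂stdGaussianPi (κ ⊕ κ)
      = ∫ g, M.av t g (fun σ => F' σ g) ∂stdGaussianPi (κ ⊕ κ) := by
  have hw (σ : S) : PolyGrowth fun (_ : Unit) g => gibbsWeight M.β (M.energy t g) σ :=
    polyGrowth_gibbsWeight (M.continuous_energy continuous_const) σ
  have hforce (σ : S) : PolyGrowth fun (_ : Unit) g => M.force t g σ :=
    (M.polyGrowth_force σ).at_param t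
  have weight_deriv (σ : S) (g : κ ⊕ κ → ℝ) : HasLineDerivAt ℝ
      (fun g => gibbsWeight M.β (M.energy t g) σ) 0 g (M.dirDeriv t σ) := by
    have h := hasDerivAt_gibbsWeight (β := M.β) (fun τ => M.hasLineDerivAt_energy t t g σ τ) σ
    simp only [sub_self, Real.sin_zero, zero_mul, gibbsAvg_const, mul_zero] at h
    exact h
  unfold av gibbsAvg
  rw [integral_finsetSum _ fun σ _ => ((hw σ).mul ((hforce σ).mul (hF σ))).integrable (),
    integral_finsetSum _ fun σ _ => ((hw σ).mul (hF' σ)).integrable ()]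
  refine Finset.sum_congr rfl fun σ _ => ?_
  rw [← integral_stdGaussianPi_by_parts (M.dirDeriv t σ) (((hw σ).mul (hF σ)).integrable ())
    (((hw σ).mul (hF' σ)).integrable ())
    (((hforce σ).mul ((hw σ).mul (hF σ))).integrable ()) fun g => ?_]
  · simp only [force, mul_left_comm]
  · have product := HasDerivAt.mul (weight_deriv σ g) (h σ g)
    simp only [zero_smul, add_zero, zero_mul, zero_add] at product
    exact product

lemma integral_av_force_mul_of_const (t : ℝ) (f : S → ℝ) :
    ∫ g, M.av t g (fun σ => M.force t g σ * f σ) ∂stdGaussianPi (κ ⊕ κ) = 0 := by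
  rw [M.integral_av_force_mul t (F := fun σ _ => f σ) (F' := fun _ _ => 0)
    (fun σ => PolyGrowth.const (f σ)) (fun _ => PolyGrowth.const 0)
    fun σ _ => hasDerivAt_const _ (f σ)]
  simp only [av, gibbsAvg_const, integral_zero]

lemma integral_av_force (t : ℝ) : ∫ g, M.av t g (M.force t g) ∂stdGaussianPi (κ ⊕ κ) = 0 := by
  simpa only [mul_one] using M.integral_av_force_mul_of_const t fun _ => 1

lemma integral_velocity (t : ℝ) :
    ∫ g, M.velocity t g ∂stdGaussianPi (κ ⊕ κ)
      = deriv M.θ t * ∫ g, M.av t g M.bulk ∂stdGaussianPi (κ ⊕ κ) := by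
  have hforce : Integrable (fun g => M.av t g (M.force t g)) (stdGaussianPi (κ ⊕ κ)) :=
    (M.polyGrowth_av_force continuous_id).integrable t
  have hbulk : Integrable (fun g => M.av t g M.bulk) (stdGaussianPi (κ ⊕ κ)) :=
    (M.polyGrowth_av_const continuous_id M.bulk).integrable t
  unfold velocity
  rw [integral_add hforce (hbulk.const_mul _), integral_av_force, integral_const_mul, zero_add]

lemma integral_av_force_mul_av (t s : ℝ) (f : S → ℝ) :
    ∫ g, M.av t g (M.force t g) * M.av s g f ∂stdGaussianPi (κ ⊕ κ)
      = -M.β * Real.sin (s - t)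
        * ∫ g, M.av t g (fun σ => M.thermalCov s g f (M.C σ)) ∂stdGaussianPi (κ ⊕ κ) := by
  have by_parts := M.integral_av_force_mul t (F := fun _ g => M.av s g f)
    (fun _ => M.polyGrowth_av_const continuous_const f)
    (fun σ => (M.polyGrowth_thermalCov_const continuous_const f (M.C σ)).const_mul _)
    fun σ g => M.hasLineDerivAt_av_const t s f g σ
  simpa only [av, gibbsAvg_mul_const, gibbsAvg_const_mul, integral_const_mul] using by_parts

lemma integral_thermalCov_force (s : ℝ) {F : (κ ⊕ κ → ℝ) → S → ℝ}
    {F' : (κ ⊕ κ → ℝ) → S → S → ℝ} (hF : ∀ τ, PolyGrowth fun (_ : Unit) g => F g τ)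
    (hF' : ∀ τ τ', PolyGrowth fun (_ : Unit) g => F' g τ τ')
    (h : ∀ τ τ' g, HasLineDerivAt ℝ (fun g => F g τ') (F' g τ τ') g (M.dirDeriv s τ)) :
    ∫ g, M.thermalCov s g (M.force s g) (F g) ∂stdGaussianPi (κ ⊕ κ)
      = ∫ g, M.av s g (fun τ => F' g τ τ - M.av s g (F' g τ)) ∂stdGaussianPi (κ ⊕ κ) := by
  rw [← M.integral_av_force_mul s (F := fun τ g => F g τ - M.av s g (F g))
    (fun τ => (hF τ).sub (M.polyGrowth_av continuous_const hF))
    (fun τ => (hF' τ τ).sub (M.polyGrowth_av continuous_const (hF' τ))) fun τ g => ?_]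
  · simp only [thermalCov, gibbsCov_eq_gibbsAvg_mul_sub, av]
  · have average := M.hasLineDerivAt_av s s fun τ' => h τ τ' g
    rw [sub_self, Real.sin_zero, mul_zero, zero_mul, sub_zero] at average
    exact HasDerivAt.fun_sub (h τ τ g) average

lemma integral_thermalCov_force_av_C (t s : ℝ) :
    ∫ g, M.thermalCov s g (M.force s g) (fun τ => M.av t g (M.C τ)) ∂stdGaussianPi (κ ⊕ κ)
      = -M.β * Real.sin (t - s) * ∫ g, M.bracket t s g ∂stdGaussianPi (κ ⊕ κ) := by
  rw [M.integral_thermalCov_force s (fun τ => M.polyGrowth_av_const continuous_const (M.C τ))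
    (fun τ τ' => (M.polyGrowth_thermalCov_const continuous_const (M.C τ') (M.C τ)).const_mul _)
    fun τ τ' g => M.hasLineDerivAt_av_const s t (M.C τ') g τ, ← integral_const_mul]
  simp only [bracket, av, gibbsAvg_const_mul, ← mul_sub]

lemma integral_av_force_mul_av_force (t s : ℝ) :
    ∫ g, M.av t g (M.force t g) * M.av s g (M.force s g) ∂stdGaussianPi (κ ⊕ κ)
      = Real.cos (t - s) * ∫ g, M.overlap t s g ∂stdGaussianPi (κ ⊕ κ)
        - M.β ^ 2 * Real.sin (t - s) ^ 2 * ∫ g, M.bracket t s g ∂stdGaussianPi (κ ⊕ κ) := by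
  have hforce (τ : S) : PolyGrowth fun (_ : Unit) g => M.force s g τ :=
    (M.polyGrowth_force τ).at_param s
  have hav (σ : S) : PolyGrowth fun (_ : Unit) g => M.av s g fun τ => Real.cos (s - t) * M.C σ τ :=
    M.polyGrowth_av_const continuous_const _
  have hcov (σ : S) : PolyGrowth fun (_ : Unit) g => M.thermalCov s g (M.force s g) (M.C σ) :=
    M.polyGrowth_thermalCov continuous_const hforce fun τ => PolyGrowth.const (M.C σ τ)
  have hoverlap : PolyGrowth fun (_ : Unit) g => M.overlap t s g :=
    M.polyGrowth_overlap continuous_const continuous_const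
  have hfluct : PolyGrowth fun (_ : Unit) g =>
      M.thermalCov s g (M.force s g) fun τ => M.av t g (M.C τ) :=
    M.polyGrowth_thermalCov continuous_const hforce fun τ =>
      M.polyGrowth_av_const continuous_const (M.C τ)
  have C_flip (τ : S) : (fun σ => M.C σ τ) = M.C τ := funext fun σ => M.C_comm σ τ
  calc ∫ g, M.av t g (M.force t g) * M.av s g (M.force s g) ∂stdGaussianPi (κ ⊕ κ)
      = ∫ g, M.av t g (fun σ => M.force t g σ * M.av s g (M.force s g))
          ∂stdGaussianPi (κ ⊕ κ) := by
        simp only [av, gibbsAvg_mul_const]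
    _ = ∫ g, M.av t g (fun σ => M.av s g (fun τ => Real.cos (s - t) * M.C σ τ)
          - M.β * Real.sin (s - t) * M.thermalCov s g (M.force s g) (M.C σ))
          ∂stdGaussianPi (κ ⊕ κ) :=
        M.integral_av_force_mul t
          (fun _ => (M.polyGrowth_av_force continuous_id).at_param s)
          (fun σ => (hav σ).sub ((hcov σ).const_mul _))
          fun σ g => M.hasLineDerivAt_av t s fun τ => M.hasLineDerivAt_force t s g σ τ
    _ = ∫ g, (Real.cos (s - t) * M.overlap t s g - M.β * Real.sin (s - t)
          * M.thermalCov s g (M.force s g) fun τ => M.av t g (M.C τ)) ∂stdGaussianPi (κ ⊕ κ) := by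
        simp only [av, overlap, thermalCov, gibbsAvg_sub, gibbsAvg_const_mul, gibbsAvg_gibbsCov,
          C_flip]
    _ = _ := by
        rw [integral_sub ((hoverlap.const_mul _).integrable ())
          ((hfluct.const_mul _).integrable ()), integral_const_mul, integral_const_mul,
          integral_thermalCov_force_av_C, ← neg_sub t s, Real.cos_neg, Real.sin_neg]
        ring

theorem integral_velocity_mul_velocity (t s : ℝ) :
    ∫ g, M.velocity t g * M.velocity s g ∂stdGaussianPi (κ ⊕ κ)
      = deriv M.θ t * deriv M.θ s
          * (∫ g, M.av t g M.bulk * M.av s g M.bulk ∂stdGaussianPi (κ ⊕ κ))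
        - M.β * (Real.sin (t - s) * deriv M.θ t * ∫ g, M.mixed t s g ∂stdGaussianPi (κ ⊕ κ))
        - M.β * (Real.sin (s - t) * deriv M.θ s * ∫ g, M.mixed s t g ∂stdGaussianPi (κ ⊕ κ))
        + Real.cos (t - s) * (∫ g, M.overlap t s g ∂stdGaussianPi (κ ⊕ κ))
        - M.β ^ 2 * (Real.sin (t - s) ^ 2 * ∫ g, M.bracket t s g ∂stdGaussianPi (κ ⊕ κ)) := by
  have hbulk (r : ℝ) : PolyGrowth fun (_ : Unit) g => M.av r g M.bulk :=
    M.polyGrowth_av_const continuous_const M.bulk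
  have hforce (r : ℝ) : PolyGrowth fun (_ : Unit) g => M.av r g (M.force r g) :=
    (M.polyGrowth_av_force continuous_id).at_param r
  have bulk_bulk := ((hbulk t).mul (hbulk s)).const_mul (deriv M.θ t * deriv M.θ s)
  have force_bulk := ((hforce t).mul (hbulk s)).const_mul (deriv M.θ s)
  have bulk_force := ((hforce s).mul (hbulk t)).const_mul (deriv M.θ t)
  have force_force := (hforce t).mul (hforce s)
  have expand (g : κ ⊕ κ → ℝ) : M.velocity t g * M.velocity s g
      = deriv M.θ t * deriv M.θ s * (M.av t g M.bulk * M.av s g M.bulk)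
        + deriv M.θ s * (M.av t g (M.force t g) * M.av s g M.bulk)
        + deriv M.θ t * (M.av s g (M.force s g) * M.av t g M.bulk)
        + M.av t g (M.force t g) * M.av s g (M.force s g) := by
    simp only [velocity]
    ring
  simp only [expand]
  rw [integral_add (((bulk_bulk.add force_bulk).add bulk_force).integrable ())
      (force_force.integrable ()),
    integral_add ((bulk_bulk.add force_bulk).integrable ()) (bulk_force.integrable ()),
    integral_add (bulk_bulk.integrable ()) (force_bulk.integrable ()),
    integral_const_mul, integral_const_mul, integral_const_mul, integral_av_force_mul_av,
    integral_av_force_mul_av, integral_av_force_mul_av_force]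
  simp only [mixed]
  ring

end IntegrationByParts

/-! ### Fluctuations of the pressure difference -/

section PressureDiff

/-- Difference of the pressures (logarithms of the partition function) at the angles `π` and
`0`. -/
def pressureDiff (g : κ ⊕ κ → ℝ) : ℝ :=
  logPartition M.β (M.energy Real.pi g) - logPartition M.β (M.energy 0 g)

lemma pressureDiff_piecewise_neg (hθ : M.θ Real.pi = M.θ 0) (g : κ ⊕ κ → ℝ) :
    M.pressureDiff ((M.region.map Function.Embedding.inl).piecewise (-g) g)
      = -M.pressureDiff g := by
  set s := M.region.map (Function.Embedding.inl : κ ↪ κ ⊕ κ)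
  have involutive : s.piecewise (-s.piecewise (-g) g) (s.piecewise (-g) g) = g := by
    funext k
    by_cases hk : k ∈ s <;> simp [hk]
  rw [pressureDiff, energy_pi_eq M hθ, involutive, pressureDiff, energy_pi_eq M hθ g, neg_sub]

variable [Nonempty S]

lemma pressureDiff_eq_integral_velocity (g : κ ⊕ κ → ℝ) :
    M.pressureDiff g = -M.β * ∫ t in (0 : ℝ)..Real.pi, M.velocity t g := by
  have h_deriv (t : ℝ) :
      HasDerivAt (fun t => logPartition M.β (M.energy t g)) (-M.β * M.velocity t g) t := by
    refine (hasDerivAt_logPartition fun σ => M.hasDerivAt_energy t g σ).congr_deriv ?_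
    rw [gibbsAvg_add, gibbsAvg_const_mul, velocity, av, av]
  rw [← intervalIntegral.integral_const_mul, intervalIntegral.integral_eq_sub_of_hasDerivAt
    (fun t _ => h_deriv t)
    (((M.polyGrowth_velocity.continuous_left g).const_mul _).intervalIntegrable _ _), pressureDiff]

lemma polyGrowth_pressureDiff : PolyGrowth fun (_ : Unit) => M.pressureDiff := by
  rw [funext M.pressureDiff_eq_integral_velocity]
  exact (M.polyGrowth_velocity.intervalIntegral 0 Real.pi).const_mul _

lemma integral_pressureDiff_sq :
    ∫ g, M.pressureDiff g ^ 2 ∂stdGaussianPi (κ ⊕ κ)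
      = M.β ^ 2 * angleIntegral fun t s =>
        ∫ g, M.velocity t g * M.velocity s g ∂stdGaussianPi (κ ⊕ κ) := by
  simp only [pressureDiff_eq_integral_velocity, mul_pow, neg_sq]
  rw [integral_const_mul, M.polyGrowth_velocity.integral_sq_intervalIntegral]

lemma sq_integral_pressureDiff :
    (∫ g, M.pressureDiff g ∂stdGaussianPi (κ ⊕ κ)) ^ 2
      = M.β ^ 2 * angleIntegral fun t s => (∫ g, M.velocity t g ∂stdGaussianPi (κ ⊕ κ))
        * ∫ g, M.velocity s g ∂stdGaussianPi (κ ⊕ κ) := by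
  simp only [pressureDiff_eq_integral_velocity]
  rw [integral_const_mul, mul_pow, neg_sq, M.polyGrowth_velocity.sq_integral_intervalIntegral]

lemma variance_pressureDiff_eq_sub :
    Var[M.pressureDiff; stdGaussianPi (κ ⊕ κ)]
      = ∫ g, M.pressureDiff g ^ 2 ∂stdGaussianPi (κ ⊕ κ)
        - (∫ g, M.pressureDiff g ∂stdGaussianPi (κ ⊕ κ)) ^ 2 := by
  simpa only [Pi.pow_apply] using variance_eq_sub (M.polyGrowth_pressureDiff.memLp_two ())

lemma abs_pressureDiff_update_sub_le {A : κ → ℝ} (hA : ∀ X σ, |M.coeff X σ| ≤ A X) (k : κ ⊕ κ)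
    (g : κ ⊕ κ → ℝ) (y : ℝ) :
    |M.pressureDiff (Function.update g k y) - M.pressureDiff g|
      ≤ 2 * |M.β| * Sum.elim A 0 k * |y - g k| := by
  have pressure_update {t : ℝ} (ht : Real.sin t = 0) :
      |logPartition M.β (M.energy t (Function.update g k y)) - logPartition M.β (M.energy t g)|
        ≤ |M.β| * (Sum.elim A 0 k * |y - g k|) :=
    abs_logPartition_sub_le fun σ => by
      rw [energy_update_sub, abs_mul]
      exact mul_le_mul_of_nonneg_right (M.abs_dir_le hA ht σ k) (abs_nonneg _)
  rw [pressureDiff, pressureDiff, sub_sub_sub_comm]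
  refine (abs_sub _ _).trans ((add_le_add (pressure_update Real.sin_pi)
    (pressure_update Real.sin_zero)).trans_eq ?_)
  ring

lemma variance_pressureDiff_le {A : κ → ℝ} (hA : ∀ X σ, |M.coeff X σ| ≤ A X) :
    Var[M.pressureDiff; stdGaussianPi (κ ⊕ κ)] ≤ 4 * M.β ^ 2 * ∑ X, A X ^ 2 := by
  refine (variance_le_sum_sq (M.polyGrowth_pressureDiff.memLp_two ())
    (M.abs_pressureDiff_update_sub_le hA)).trans_eq ?_
  simp only [mul_pow, sq_abs, ← Finset.mul_sum, Fintype.sum_sum_type, Sum.elim_inl, Sum.elim_inr,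
    Pi.zero_apply]
  norm_num

lemma integral_pressureDiff_sq_le (hθ : M.θ Real.pi = M.θ 0) {A : κ → ℝ}
    (hA : ∀ X σ, |M.coeff X σ| ≤ A X) :
    ∫ g, M.pressureDiff g ^ 2 ∂stdGaussianPi (κ ⊕ κ)
      ≤ 4 * M.β ^ 2 * ∑ X ∈ M.region, A X ^ 2 := by
  refine (integral_sq_le_sum_sq_of_odd (M.polyGrowth_pressureDiff.memLp_two ())
    (M.abs_pressureDiff_update_sub_le hA) (M.pressureDiff_piecewise_neg hθ)).trans_eq ?_
  simp only [mul_pow, sq_abs, ← Finset.mul_sum, Finset.sum_map, Function.Embedding.inl_apply,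
    Sum.elim_inl]
  norm_num

end PressureDiff

/-! ### The mixed term -/

section Mixed

variable [Nonempty S]

lemma hasDerivAt_av (f : S → ℝ) (t : ℝ) (g : κ ⊕ κ → ℝ) :
    HasDerivAt (fun t => M.av t g f)
      (-M.β * (M.thermalCov t g (M.force t g) f + deriv M.θ t * M.thermalCov t g M.bulk f)) t := by
  refine (hasDerivAt_gibbsAvg (f' := fun _ => 0) (fun σ => M.hasDerivAt_energy t g σ)
    fun σ => hasDerivAt_const t (f σ)).congr_deriv ?_
  rw [gibbsAvg_const, gibbsCov_add_right, gibbsCov_const_mul_right, thermalCov, thermalCov,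
    gibbsCov_comm, gibbsCov_comm (h := M.bulk)]
  ring

lemma integral_thermalCov_force_of_const (t : ℝ) (f : S → ℝ) :
    ∫ g, M.thermalCov t g (M.force t g) f ∂stdGaussianPi (κ ⊕ κ) = 0 := by
  rw [M.integral_thermalCov_force t (F := fun _ => f) (F' := fun _ _ _ => 0)
    (fun τ => PolyGrowth.const (f τ)) (fun _ _ => PolyGrowth.const 0)
    fun _ τ' _ => hasDerivAt_const _ (f τ')]
  simp only [av, gibbsAvg_const, sub_self, integral_zero]

/-- The coupling part of the derivative has mean zero, so only the modulation of the bulk energy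
drives the mean. -/
lemma integral_av_sub_integral_av (f : S → ℝ) (a b : ℝ) :
    ∫ g, M.av b g f ∂stdGaussianPi (κ ⊕ κ) - ∫ g, M.av a g f ∂stdGaussianPi (κ ⊕ κ)
      = -M.β * ∫ t in a..b,
          deriv M.θ t * ∫ g, M.thermalCov t g M.bulk f ∂stdGaussianPi (κ ⊕ κ) := by
  have hav : PolyGrowth fun t g => M.av t g f := M.polyGrowth_av_const continuous_id f
  have hforce : PolyGrowth fun t g => M.thermalCov t g (M.force t g) f :=
    M.polyGrowth_thermalCov continuous_id M.polyGrowth_force fun σ => PolyGrowth.const (f σ)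
  have hbulk : PolyGrowth fun t g => deriv M.θ t * M.thermalCov t g M.bulk f :=
    (PolyGrowth.of_param M.continuous_deriv_θ).mul
      (M.polyGrowth_thermalCov_const continuous_id M.bulk f)
  have hderiv := (hforce.add hbulk).const_mul (-M.β)
  have fundamental (g : κ ⊕ κ → ℝ) := intervalIntegral.integral_eq_sub_of_hasDerivAt
    (fun t _ => M.hasDerivAt_av f t g) ((hderiv.continuous_left g).intervalIntegrable a b)
  have mean_deriv (t : ℝ) : ∫ g, -M.β * (M.thermalCov t g (M.force t g) f
        + deriv M.θ t * M.thermalCov t g M.bulk f) ∂stdGaussianPi (κ ⊕ κ)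
      = -M.β * (deriv M.θ t * ∫ g, M.thermalCov t g M.bulk f ∂stdGaussianPi (κ ⊕ κ)) := by
    rw [integral_const_mul, integral_add (hforce.integrable t) (hbulk.integrable t),
      integral_thermalCov_force_of_const, zero_add, integral_const_mul]
  rw [← integral_sub (hav.integrable b) (hav.integrable a)]
  simp only [← fundamental]
  rw [← hderiv.intervalIntegral_integral_swap]
  simp only [mean_deriv, intervalIntegral.integral_const_mul]

/-- Mean thermal variance of the bulk energy. -/
def bulkVariance (t : ℝ) : ℝ :=
  ∫ g, M.thermalCov t g M.bulk M.bulk ∂stdGaussianPi (κ ⊕ κ)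

lemma continuous_bulkVariance : Continuous M.bulkVariance :=
  (M.polyGrowth_thermalCov_const continuous_id M.bulk M.bulk).continuous_integral

lemma abs_integral_av_le {f : (κ ⊕ κ → ℝ) → S → ℝ} {N : ℝ} (hN : ∀ g σ, |f g σ| ≤ N) (t : ℝ) :
    |∫ g, M.av t g (f g) ∂stdGaussianPi (κ ⊕ κ)| ≤ N := by
  simpa using norm_integral_le_of_norm_le_const (μ := stdGaussianPi (κ ⊕ κ))
    (f := fun g => M.av t g (f g)) (C := N)
    (ae_of_all _ fun g => abs_gibbsAvg_le (β := M.β) (E := M.energy t g) (hN g))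

lemma abs_mul_integral_deriv_mul_bulkVariance_le {N : ℝ} (hN : ∀ σ, |M.bulk σ| ≤ N) (a b : ℝ) :
    |M.β| * |∫ t in a..b, deriv M.θ t * M.bulkVariance t| ≤ 2 * N := by
  rw [← abs_mul, ← abs_neg, ← neg_mul]
  unfold bulkVariance
  rw [← integral_av_sub_integral_av, two_mul]
  exact (abs_sub _ _).trans (add_le_add (M.abs_integral_av_le (fun _ => hN) b)
    (M.abs_integral_av_le (fun _ => hN) a))

lemma abs_mul_integral_abs_deriv_mul_bulkVariance_le {N : ℝ} (hN : ∀ σ, |M.bulk σ| ≤ N) {c : ℝ}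
    (hc : c ∈ Set.Icc 0 Real.pi) (hpos : ∀ t ∈ Set.Icc 0 c, 0 ≤ deriv M.θ t)
    (hneg : ∀ t ∈ Set.Icc c Real.pi, deriv M.θ t ≤ 0) :
    |M.β| * ∫ t in (0 : ℝ)..Real.pi, |deriv M.θ t| * M.bulkVariance t ≤ 4 * N := by
  have hcont : Continuous fun t => |deriv M.θ t| * M.bulkVariance t :=
    M.continuous_deriv_θ.abs.mul M.continuous_bulkVariance
  have increasing : ∫ t in (0 : ℝ)..c, |deriv M.θ t| * M.bulkVariance t
      = ∫ t in (0 : ℝ)..c, deriv M.θ t * M.bulkVariance t :=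
    intervalIntegral.integral_congr fun t ht => by
      rw [Set.uIcc_of_le hc.1] at ht
      simp only [abs_of_nonneg (hpos t ht)]
  have decreasing : ∫ t in c..Real.pi, |deriv M.θ t| * M.bulkVariance t
      = -∫ t in c..Real.pi, deriv M.θ t * M.bulkVariance t := by
    rw [← intervalIntegral.integral_neg]
    refine intervalIntegral.integral_congr fun t ht => ?_
    rw [Set.uIcc_of_le hc.2] at ht
    simp only [abs_of_nonpos (hneg t ht), neg_mul]
  rw [← intervalIntegral.integral_add_adjacent_intervals (hcont.intervalIntegrable 0 c)
    (hcont.intervalIntegrable c Real.pi), increasing, decreasing, mul_add]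
  have bound (a b : ℝ) := M.abs_mul_integral_deriv_mul_bulkVariance_le hN a b
  have left := (mul_le_mul_of_nonneg_left (le_abs_self _) (abs_nonneg M.β)).trans (bound 0 c)
  have right := (mul_le_mul_of_nonneg_left (neg_le_abs _) (abs_nonneg M.β)).trans
    (bound c Real.pi)
  linarith

lemma abs_integral_mixed_le {R δ : ℝ} (hδ : 0 < δ) (hC : ∀ σ τ, |M.C σ τ| ≤ R) (t s : ℝ) :
    |∫ g, M.mixed t s g ∂stdGaussianPi (κ ⊕ κ)| ≤ R * (δ / 2 + M.bulkVariance t / (2 * δ)) := by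
  have hvar : Integrable (fun g => M.thermalCov t g M.bulk M.bulk) (stdGaussianPi (κ ⊕ κ)) :=
    (M.polyGrowth_thermalCov_const continuous_id M.bulk M.bulk).integrable t
  have hmixed : Integrable (M.mixed t s) (stdGaussianPi (κ ⊕ κ)) :=
    (M.polyGrowth_mixed continuous_id continuous_const).integrable t
  have hbound : Integrable (fun g => δ / 2 + M.thermalCov t g M.bulk M.bulk / (2 * δ))
      (stdGaussianPi (κ ⊕ κ)) := (integrable_const _).add (hvar.div_const _)
  calc |∫ g, M.mixed t s g ∂stdGaussianPi (κ ⊕ κ)|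
      ≤ ∫ g, |M.mixed t s g| ∂stdGaussianPi (κ ⊕ κ) := abs_integral_le_integral_abs
    _ ≤ ∫ g, R * (δ / 2 + M.thermalCov t g M.bulk M.bulk / (2 * δ)) ∂stdGaussianPi (κ ⊕ κ) :=
      integral_mono hmixed.abs (hbound.const_mul R) fun g =>
        abs_gibbsAvg_le fun τ => abs_gibbsCov_le hδ (hC τ)
    _ = R * (δ / 2 + M.bulkVariance t / (2 * δ)) := by
      rw [integral_const_mul, integral_add (integrable_const _) (hvar.div_const _),
        integral_const, integral_div, probReal_univ, one_smul, bulkVariance]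

/-- The mixed term of the flip identity. -/
def mixedIntegral : ℝ := angleIntegral fun t s =>
  Real.sin (t - s) * deriv M.θ t * ∫ g, M.mixed t s g ∂stdGaussianPi (κ ⊕ κ)

lemma continuous_mixedIntegrand : Continuous fun p : ℝ × ℝ =>
    Real.sin (p.1 - p.2) * deriv M.θ p.1
      * ∫ g, M.mixed p.1 p.2 g ∂stdGaussianPi (κ ⊕ κ) := by
  have hmixed := (M.polyGrowth_mixed continuous_fst continuous_snd).continuous_integral
  have hθ := M.continuous_deriv_θ
  fun_prop

/-- The mean thermal variance of the bulk energy is an angular derivative, so it stays bounded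
after integration over the angle although it may be of order `N ^ 2` pointwise. -/
lemma abs_mul_abs_mixedIntegral_le {N R δ : ℝ} (hδ : 0 < δ) (hN : ∀ σ, |M.bulk σ| ≤ N)
    (hC : ∀ σ τ, |M.C σ τ| ≤ R) {c : ℝ} (hc : c ∈ Set.Icc 0 Real.pi)
    (hpos : ∀ t ∈ Set.Icc 0 c, 0 ≤ deriv M.θ t)
    (hneg : ∀ t ∈ Set.Icc c Real.pi, deriv M.θ t ≤ 0) :
    |M.β| * |M.mixedIntegral|
      ≤ Real.pi * (R * (|M.β| * (δ / 2) * (∫ t in (0 : ℝ)..Real.pi, |deriv M.θ t|)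
        + 2 * N / δ)) := by
  obtain ⟨σ₀⟩ := ‹Nonempty S›
  have hR : 0 ≤ R := (abs_nonneg _).trans (hC σ₀ σ₀)
  have hθ := M.continuous_deriv_θ
  have hV := M.continuous_bulkVariance
  have majorant : |M.mixedIntegral| ≤ Real.pi * ∫ t in (0 : ℝ)..Real.pi,
      (R * (δ / 2) * |deriv M.θ t| + R / (2 * δ) * (|deriv M.θ t| * M.bulkVariance t)) := by
    refine abs_angleIntegral_le (by fun_prop) M.continuous_mixedIntegrand fun t s => ?_
    rw [abs_mul, abs_mul]
    calc |Real.sin (t - s)| * |deriv M.θ t| * |∫ g, M.mixed t s g ∂stdGaussianPi (κ ⊕ κ)|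
        ≤ |deriv M.θ t| * (R * (δ / 2 + M.bulkVariance t / (2 * δ))) :=
          mul_le_mul (mul_le_of_le_one_left (abs_nonneg _) (Real.abs_sin_le_one _))
            (M.abs_integral_mixed_le hδ hC t s) (abs_nonneg _) (abs_nonneg _)
      _ = _ := by ring
  rw [intervalIntegral.integral_add (Continuous.intervalIntegrable (by fun_prop) _ _)
      (Continuous.intervalIntegrable (by fun_prop) _ _), intervalIntegral.integral_const_mul,
    intervalIntegral.integral_const_mul] at majorant
  have variance_bound : R / (2 * δ)
      * (|M.β| * ∫ t in (0 : ℝ)..Real.pi, |deriv M.θ t| * M.bulkVariance t)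
      ≤ R / (2 * δ) * (4 * N) :=
    mul_le_mul_of_nonneg_left
      (M.abs_mul_integral_abs_deriv_mul_bulkVariance_le hN hc hpos hneg) (by positivity)
  calc |M.β| * |M.mixedIntegral|
      ≤ |M.β| * (Real.pi * (R * (δ / 2) * (∫ t in (0 : ℝ)..Real.pi, |deriv M.θ t|)
          + R / (2 * δ) * ∫ t in (0 : ℝ)..Real.pi, |deriv M.θ t| * M.bulkVariance t)) :=
        mul_le_mul_of_nonneg_left majorant (abs_nonneg _)
    _ = Real.pi * (R * (|M.β| * (δ / 2) * ∫ t in (0 : ℝ)..Real.pi, |deriv M.θ t|)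
          + R / (2 * δ)
            * (|M.β| * ∫ t in (0 : ℝ)..Real.pi, |deriv M.θ t| * M.bulkVariance t)) := by ring
    _ ≤ Real.pi * (R * (|M.β| * (δ / 2) * ∫ t in (0 : ℝ)..Real.pi, |deriv M.θ t|)
          + R / (2 * δ) * (4 * N)) := by gcongr
    _ = _ := by ring

end Mixed

/-! ### The flip identity -/

section Identity

variable [Nonempty S]

/-- The bulk term of the flip identity: covariance over the disorder of the modulated bulk
energies. -/
def bulkIntegral : ℝ := angleIntegral fun t s => deriv M.θ t * deriv M.θ s
  * (∫ g, M.av t g M.bulk * M.av s g M.bulk ∂stdGaussianPi (κ ⊕ κ)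
    - (∫ g, M.av t g M.bulk ∂stdGaussianPi (κ ⊕ κ))
      * ∫ g, M.av s g M.bulk ∂stdGaussianPi (κ ⊕ κ))

/-- The overlap term of the flip identity. -/
def overlapIntegral : ℝ := angleIntegral fun t s =>
  Real.sin (t - s) ^ 2 * ∫ g, M.bracket t s g ∂stdGaussianPi (κ ⊕ κ)

lemma continuous_overlapIntegrand : Continuous fun p : ℝ × ℝ =>
    Real.sin (p.1 - p.2) ^ 2 * ∫ g, M.bracket p.1 p.2 g ∂stdGaussianPi (κ ⊕ κ) := by
  have hbracket := (M.polyGrowth_bracket continuous_fst continuous_snd).continuous_integral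
  fun_prop

lemma integral_bracket (t s : ℝ) :
    ∫ g, M.bracket t s g ∂stdGaussianPi (κ ⊕ κ)
      = ∫ g, M.overlapSq t s g ∂stdGaussianPi (κ ⊕ κ)
        - ∫ g, M.overlapChain t s g ∂stdGaussianPi (κ ⊕ κ)
        - ∫ g, M.overlapChain s t g ∂stdGaussianPi (κ ⊕ κ)
        + ∫ g, M.overlap t s g ^ 2 ∂stdGaussianPi (κ ⊕ κ) := by
  have sq : PolyGrowth fun (_ : Unit) g => M.overlapSq t s g :=
    M.polyGrowth_overlapSq continuous_const continuous_const
  have chain (t s : ℝ) : PolyGrowth fun (_ : Unit) g => M.overlapChain t s g :=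
    M.polyGrowth_overlapChain continuous_const continuous_const
  have single : PolyGrowth fun (_ : Unit) g => M.overlap t s g :=
    M.polyGrowth_overlap continuous_const continuous_const
  simp only [bracket_eq]
  rw [integral_add (((sq.sub (chain t s)).sub (chain s t)).integrable ()) (single.sq.integrable ()),
    integral_sub ((sq.sub (chain t s)).integrable ()) ((chain s t).integrable ()),
    integral_sub (sq.integrable ()) ((chain t s).integrable ())]

lemma overlapIntegral_eq : M.overlapIntegral = angleIntegral fun t s => Real.sin (t - s) ^ 2 *
    (∫ g, M.overlapSq t s g ∂stdGaussianPi (κ ⊕ κ)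
      - 2 * ∫ g, M.overlapChain t s g ∂stdGaussianPi (κ ⊕ κ)
      + ∫ g, M.overlap t s g ^ 2 ∂stdGaussianPi (κ ⊕ κ)) := by
  have hsq := (M.polyGrowth_overlapSq continuous_fst continuous_snd).continuous_integral
  have hchain := (M.polyGrowth_overlapChain continuous_fst continuous_snd).continuous_integral
  have hsingle := (M.polyGrowth_overlap continuous_fst continuous_snd).sq.continuous_integral
  refine angleIntegral_eq_of_add_swap_eq M.continuous_overlapIntegrand (by fun_prop) fun t s => ?_
  rw [← neg_sub t s, Real.sin_neg, neg_sq, integral_bracket, integral_bracket]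
  ring

lemma overlapIntegral_eq_swap :
    M.overlapIntegral = angleIntegral fun t s => Real.sin (t - s) ^ 2 *
      (∫ g, M.overlapSq t s g ∂stdGaussianPi (κ ⊕ κ)
        - 2 * ∫ g, M.overlapChain s t g ∂stdGaussianPi (κ ⊕ κ)
        + ∫ g, M.overlap t s g ^ 2 ∂stdGaussianPi (κ ⊕ κ)) := by
  have hsq := (M.polyGrowth_overlapSq continuous_fst continuous_snd).continuous_integral
  have hchain := (M.polyGrowth_overlapChain continuous_snd continuous_fst).continuous_integral
  have hsingle := (M.polyGrowth_overlap continuous_fst continuous_snd).sq.continuous_integral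
  refine angleIntegral_eq_of_add_swap_eq M.continuous_overlapIntegrand (by fun_prop) fun t s => ?_
  rw [← neg_sub t s, Real.sin_neg, neg_sq, integral_bracket, integral_bracket]
  ring

lemma continuous_cos_mul_integral_overlap : Continuous fun p : ℝ × ℝ =>
    Real.cos (p.1 - p.2) * ∫ g, M.overlap p.1 p.2 g ∂stdGaussianPi (κ ⊕ κ) := by
  have hoverlap := (M.polyGrowth_overlap continuous_fst continuous_snd).continuous_integral
  fun_prop

lemma abs_angleIntegral_cos_mul_overlap_le {R : ℝ} (hC : ∀ σ τ, |M.C σ τ| ≤ R) :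
    |angleIntegral fun t s => Real.cos (t - s) * ∫ g, M.overlap t s g ∂stdGaussianPi (κ ⊕ κ)|
      ≤ Real.pi ^ 2 * R := by
  have overlap_le (t s : ℝ) : |∫ g, M.overlap t s g ∂stdGaussianPi (κ ⊕ κ)| ≤ R :=
    M.abs_integral_av_le (fun g σ => abs_gibbsAvg_le (hC σ)) t
  refine (abs_angleIntegral_le (ψ := fun _ => R) continuous_const
    M.continuous_cos_mul_integral_overlap fun t s => ?_).trans_eq ?_
  · rw [abs_mul]
    exact (mul_le_of_le_one_left (abs_nonneg _) (Real.abs_cos_le_one _)).trans (overlap_le t s)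
  · rw [intervalIntegral.integral_const, sub_zero, smul_eq_mul]
    ring

theorem variance_pressureDiff : Var[M.pressureDiff; stdGaussianPi (κ ⊕ κ)]
    = M.β ^ 2 * M.bulkIntegral - 2 * M.β ^ 3 * M.mixedIntegral
      + M.β ^ 2 * (angleIntegral fun t s =>
        Real.cos (t - s) * ∫ g, M.overlap t s g ∂stdGaussianPi (κ ⊕ κ))
      - M.β ^ 4 * M.overlapIntegral := by
  have hθ := M.continuous_deriv_θ
  have hfst := M.polyGrowth_av_const (continuous_fst (X := ℝ) (Y := ℝ)) M.bulk
  have hsnd := M.polyGrowth_av_const (continuous_snd (X := ℝ) (Y := ℝ)) M.bulk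
  have hbulk_fst := hfst.continuous_integral
  have hbulk_snd := hsnd.continuous_integral
  have hbulk_bulk := (hfst.mul hsnd).continuous_integral
  have hmixed := M.continuous_mixedIntegrand
  have hmixed_swap := hmixed.comp continuous_swap
  have mixed_swap : angleIntegral (fun t s => Real.sin (s - t) * deriv M.θ s
      * ∫ g, M.mixed s t g ∂stdGaussianPi (κ ⊕ κ)) = M.mixedIntegral := angleIntegral_swap hmixed
  have hcos := M.continuous_cos_mul_integral_overlap
  have hoverlap := M.continuous_overlapIntegrand
  simp only [Function.comp_def, Prod.fst_swap, Prod.snd_swap] at hmixed_swap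
  rw [variance_pressureDiff_eq_sub, integral_pressureDiff_sq, sq_integral_pressureDiff,
    bulkIntegral]
  simp only [integral_velocity_mul_velocity, integral_velocity, mul_sub]
  rw [angleIntegral_sub ?_ ?_, angleIntegral_add ?_ hcos, angleIntegral_sub ?_ ?_,
    angleIntegral_sub ?_ ?_, angleIntegral_const_mul, angleIntegral_const_mul,
    angleIntegral_const_mul, mixed_swap, ← mixedIntegral, ← overlapIntegral,
    angleIntegral_sub ?_ ?_]
  · simp only [mul_mul_mul_comm]
    ring
  all_goals fun_prop

/-- Without modulation of the bulk energy the pressure difference is odd in the rotated couplings,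
so that its second moment, hence its variance, is controlled by these couplings alone. -/
theorem abs_overlapIntegral_le (hθ : ∀ t, deriv M.θ t = 0) {A : κ → ℝ}
    (hA : ∀ X σ, |M.coeff X σ| ≤ A X) :
    M.β ^ 4 * |M.overlapIntegral|
      ≤ M.β ^ 2 * ((4 + Real.pi ^ 2) * ∑ X ∈ M.region, A X ^ 2) := by
  have θ_const : M.θ Real.pi = M.θ 0 :=
    is_const_of_deriv_eq_zero (M.contDiff_θ.differentiable one_ne_zero) hθ _ _
  have bulk_zero : M.bulkIntegral = 0 := by simp [bulkIntegral, angleIntegral, hθ]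
  have mixed_zero : M.mixedIntegral = 0 := by simp [mixedIntegral, angleIntegral, hθ]
  have identity := M.variance_pressureDiff
  have second_moment := M.integral_pressureDiff_sq_le θ_const hA
  have variance_le := (M.variance_pressureDiff_eq_sub.trans_le
    (sub_le_self _ (sq_nonneg _))).trans second_moment
  have variance_nonneg := variance_nonneg M.pressureDiff (stdGaussianPi (κ ⊕ κ))
  obtain ⟨cos_lower, cos_upper⟩ :=
    abs_le.1 (M.abs_angleIntegral_cos_mul_overlap_le (M.abs_C_le hA))
  have lower := mul_le_mul_of_nonneg_left cos_lower (sq_nonneg M.β)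
  have upper := mul_le_mul_of_nonneg_left cos_upper (sq_nonneg M.β)
  rw [bulk_zero, mixed_zero] at identity
  rw [← abs_of_nonneg (by positivity : 0 ≤ M.β ^ 4), ← abs_mul, abs_le]
  constructor <;> linarith

theorem abs_flip_identity_le {A : κ → ℝ} (hA : ∀ X σ, |M.coeff X σ| ≤ A X) :
    |M.β ^ 2 * M.bulkIntegral + 2 * M.β ^ 3 * M.mixedIntegral - M.β ^ 4 * M.overlapIntegral|
      ≤ M.β ^ 2 * (4 * ∑ X, A X ^ 2 + Real.pi ^ 2 * ∑ X ∈ M.region, A X ^ 2)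
        + 4 * |M.β| ^ 3 * |M.mixedIntegral| := by
  have variance_le := M.variance_pressureDiff_le hA
  have variance_nonneg := variance_nonneg M.pressureDiff (stdGaussianPi (κ ⊕ κ))
  have cos_le := M.abs_angleIntegral_cos_mul_overlap_le (M.abs_C_le hA)
  set cosIntegral := angleIntegral fun t s =>
    Real.cos (t - s) * ∫ g, M.overlap t s g ∂stdGaussianPi (κ ⊕ κ)
  have identity : M.β ^ 2 * M.bulkIntegral + 2 * M.β ^ 3 * M.mixedIntegral
        - M.β ^ 4 * M.overlapIntegral
      = Var[M.pressureDiff; stdGaussianPi (κ ⊕ κ)] - M.β ^ 2 * cosIntegral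
        + 4 * M.β ^ 3 * M.mixedIntegral := by
    rw [variance_pressureDiff]
    ring
  calc |M.β ^ 2 * M.bulkIntegral + 2 * M.β ^ 3 * M.mixedIntegral - M.β ^ 4 * M.overlapIntegral|
      ≤ |Var[M.pressureDiff; stdGaussianPi (κ ⊕ κ)]| + |M.β ^ 2 * cosIntegral|
        + |4 * M.β ^ 3 * M.mixedIntegral| := by
        rw [identity]
        exact (abs_add_le _ _).trans (add_le_add_left (abs_sub _ _) _)
    _ ≤ 4 * M.β ^ 2 * ∑ X, A X ^ 2 + M.β ^ 2 * (Real.pi ^ 2 * ∑ X ∈ M.region, A X ^ 2)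
        + 4 * |M.β| ^ 3 * |M.mixedIntegral| := by
        rw [abs_of_nonneg variance_nonneg, abs_mul, abs_mul, abs_mul, abs_pow, abs_pow, sq_abs,
          Nat.abs_ofNat]
        gcongr
    _ = _ := by ring

end Identity

end FlipModel

/-! ### Replicas -/

section Replicas

variable {d : ℕ} {Λ : Finset (Site d)} {β : ℝ}

lemma boltzmann_eq_gibbsWeight (E : SpinConfig Λ → ℝ) (σ : SpinConfig Λ) :
    boltzmann β E σ = gibbsWeight β E σ := rfl

lemma randomState_zero (E : Fin 0 → SpinConfig Λ → ℝ) (f : (Fin 0 → SpinConfig Λ) → ℝ) :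
    randomState β E f = f default := by
  rw [randomState, Fintype.sum_unique, Fin.prod_univ_zero, mul_one]
  exact congrArg f (Subsingleton.elim _ _)

lemma randomState_succ {n : ℕ} (E : Fin (n + 1) → SpinConfig Λ → ℝ)
    (f : (Fin (n + 1) → SpinConfig Λ) → ℝ) :
    randomState β E f = gibbsAvg β (E 0) fun x =>
      randomState β (fun k => E k.succ) fun σ => f (Fin.cons x σ) := by
  unfold randomState gibbsAvg
  rw [← (Fin.consEquiv fun _ : Fin (n + 1) => SpinConfig Λ).sum_comp, Fintype.sum_prod_type]
  refine Finset.sum_congr rfl fun x _ => ?_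
  rw [Finset.mul_sum]
  refine Finset.sum_congr rfl fun σ _ => ?_
  have consEquiv_apply :
      (Fin.consEquiv fun _ : Fin (n + 1) => SpinConfig Λ) (x, σ) = Fin.cons x σ := rfl
  rw [consEquiv_apply, Fin.prod_univ_succ]
  simp only [Fin.cons_zero, Fin.cons_succ, boltzmann_eq_gibbsWeight]
  ring

lemma randomState_const_mul {n : ℕ} (E : Fin n → SpinConfig Λ → ℝ) (a : ℝ)
    (f : (Fin n → SpinConfig Λ) → ℝ) :
    randomState β E (fun σ => a * f σ) = a * randomState β E f := by
  simp only [randomState, Finset.mul_sum, mul_assoc]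

lemma continuous_randomState {n : ℕ} {Y : Type*} [TopologicalSpace Y]
    {E : Fin n → Y → SpinConfig Λ → ℝ} (hE : ∀ k σ, Continuous fun y => E k y σ)
    (f : (Fin n → SpinConfig Λ) → ℝ) :
    Continuous fun y => randomState β (fun k => E k y) f := by
  unfold randomState boltzmann
  refine continuous_finsetSum _ fun σ _ =>
    continuous_const.mul (continuous_finsetProd _ fun k _ => Continuous.div ?_ ?_ fun y => ?_)
  · exact Real.continuous_exp.comp ((hE k _).const_mul _)
  · exact continuous_finsetSum _ fun τ _ => Real.continuous_exp.comp ((hE k τ).const_mul _)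
  · exact (partition_pos β (E k y)).ne'

section Quenched

variable {Ω : Type*} [MeasurableSpace Ω] {P : Measure Ω} {H : ℝ → Ω → SpinConfig Λ → ℝ}

lemma quenched_const_mul {n : ℕ} (t : Fin n → ℝ) (a : ℝ) (f : (Fin n → SpinConfig Λ) → ℝ) :
    quenched P β H t (fun σ => a * f σ) = a * quenched P β H t f := by
  simp only [quenched, randomState_const_mul, integral_const_mul]

/-- The double integral of overlaps in part (1) of the theorem, for a random Hamiltonian `H` and a
replica covariance `c`. -/
def overlapFunctional (P : Measure Ω) (β : ℝ) (H : ℝ → Ω → SpinConfig Λ → ℝ)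
    (c : SpinConfig Λ → SpinConfig Λ → ℝ) : ℝ :=
  angleIntegral fun t s => k₂ t s *
    (quenched P β H ![t, s] (fun σ => c (σ 0) (σ 1) ^ 2)
      - 2 * quenched P β H ![t, s, t] (fun σ => c (σ 0) (σ 1) * c (σ 1) (σ 2))
      + quenched P β H ![t, s, s, t] (fun σ => c (σ 0) (σ 1) * c (σ 2) (σ 3)))

/-- The quantity in braces in part (2) of the theorem, for a random Hamiltonian `H`, a
magnetization `m` and a replica covariance `c`. -/
def flipFunctional (P : Measure Ω) (β : ℝ) (H : ℝ → Ω → SpinConfig Λ → ℝ) (m : SpinConfig Λ → ℝ)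
    (c : SpinConfig Λ → SpinConfig Λ → ℝ) : ℝ :=
  β ^ 2 * (angleIntegral fun t s => h₁ t s *
      (quenched P β H ![t, s] (fun σ => m (σ 0) * m (σ 1))
        - quenched P β H ![t] (fun σ => m (σ 0)) * quenched P β H ![s] (fun σ => m (σ 0))))
    + 2 * β ^ 3 * (angleIntegral fun t s => h₂ t s *
      (quenched P β H ![t, s] (fun σ => m (σ 0) * c (σ 0) (σ 1))
        - quenched P β H ![t, s, t] (fun σ => m (σ 0) * c (σ 1) (σ 2))))
    - β ^ 4 * (angleIntegral fun t s => k₂ t s *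
      (quenched P β H ![t, s] (fun σ => c (σ 0) (σ 1) ^ 2)
        - 2 * quenched P β H ![s, t, s] (fun σ => c (σ 0) (σ 1) * c (σ 1) (σ 2))
        + quenched P β H ![t, s, s, t] (fun σ => c (σ 0) (σ 1) * c (σ 2) (σ 3))))

lemma overlapFunctional_const_mul (a : ℝ) (c : SpinConfig Λ → SpinConfig Λ → ℝ) :
    overlapFunctional P β H (fun σ τ => a * c σ τ) = a ^ 2 * overlapFunctional P β H c := by
  simp only [overlapFunctional, ← angleIntegral_const_mul, mul_pow, mul_mul_mul_comm a, ← pow_two,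
    quenched_const_mul]
  congr! 3
  ring

lemma flipFunctional_const_mul (a : ℝ) (m : SpinConfig Λ → ℝ)
    (c : SpinConfig Λ → SpinConfig Λ → ℝ) :
    flipFunctional P β H (fun σ => a * m σ) (fun σ τ => a * c σ τ)
      = a ^ 2 * flipFunctional P β H m c := by
  have rescale (w F : ℝ → ℝ → ℝ) : (angleIntegral fun t s => w t s * (a ^ 2 * F t s))
      = a ^ 2 * angleIntegral fun t s => w t s * F t s := by
    simp only [mul_left_comm _ (a ^ 2), angleIntegral_const_mul]
  simp only [flipFunctional, mul_pow, mul_mul_mul_comm a, ← pow_two, quenched_const_mul]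
  simp only [pow_two a, mul_left_comm (2 : ℝ), ← mul_sub, ← mul_add]
  simp only [← pow_two a, rescale]
  ring

end Quenched

end Replicas

namespace FlipModel

section Replicas

variable {κ S : Type*} [DecidableEq κ] [Fintype κ] [Fintype S] (M : FlipModel κ S)

lemma overlapChain_eq_av (t s : ℝ) (g : κ ⊕ κ → ℝ) :
    M.overlapChain t s g
      = M.av t g fun x => M.av s g fun y => M.av t g fun z => M.C x y * M.C y z := by
  have C_flip (τ : S) : (fun σ => M.C σ τ) = M.C τ := funext fun σ => M.C_comm σ τ
  simp only [overlapChain, av, gibbsAvg_const_mul]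
  rw [gibbsAvg_comm]
  simp only [gibbsAvg_mul_const, C_flip, pow_two]

lemma overlap_sq_eq_av (t s : ℝ) (g : κ ⊕ κ → ℝ) :
    M.overlap t s g ^ 2 = M.av t g fun x => M.av s g fun y =>
      M.av s g fun z => M.av t g fun u => M.C x y * M.C z u := by
  have C_flip (τ : S) : (fun σ => M.C σ τ) = M.C τ := funext fun σ => M.C_comm σ τ
  have overlap_swap : M.overlap t s g = M.av s g fun z => M.av t g (M.C z) := by
    simp only [overlap, av]
    rw [gibbsAvg_comm]
    simp only [C_flip]
  rw [pow_two]
  nth_rewrite 2 [overlap_swap]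
  simp only [overlap, av, gibbsAvg_const_mul, gibbsAvg_mul_const]

lemma mixed_eq_av_sub_av (t s : ℝ) (g : κ ⊕ κ → ℝ) :
    M.mixed t s g = (M.av t g fun x => M.av s g fun y => M.bulk x * M.C x y)
      - M.av t g fun x => M.av s g fun y => M.av t g fun z => M.bulk x * M.C y z := by
  have exchange : (M.av t g fun x => M.av s g fun y => M.bulk x * M.C x y)
      = M.av s g fun y => M.av t g fun x => M.bulk x * M.C y x := by
    simp only [av]
    rw [gibbsAvg_comm]
    simp only [M.C_comm]
  rw [exchange]
  simp only [mixed, thermalCov, gibbsCov, av, gibbsAvg_sub, gibbsAvg_const_mul,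
    gibbsAvg_mul_const]

end Replicas

section Represents

variable {κ : Type*} [DecidableEq κ] [Fintype κ] {d : ℕ} {Λ : Finset (Site d)} {Ω : Type*}
  [MeasurableSpace Ω] {M : FlipModel κ (SpinConfig Λ)} {P : Measure Ω}
  {H : ℝ → Ω → SpinConfig Λ → ℝ}

/-- The random Hamiltonian `H` has the quenched states of the model `M` with standard Gaussian
couplings. -/
def Represents (M : FlipModel κ (SpinConfig Λ)) (P : Measure Ω)
    (H : ℝ → Ω → SpinConfig Λ → ℝ) : Prop :=
  ∀ ⦃n : ℕ⦄ (t : Fin n → ℝ) (f : (Fin n → SpinConfig Λ) → ℝ), quenched P M.β H t f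
    = ∫ g, randomState M.β (fun k => M.energy (t k) g) f ∂stdGaussianPi (κ ⊕ κ)

namespace Represents

lemma quenched_one (hM : M.Represents P H) (t : ℝ) (F : SpinConfig Λ → ℝ) :
    quenched P M.β H ![t] (fun σ => F (σ 0)) = ∫ g, M.av t g F ∂stdGaussianPi (κ ⊕ κ) := by
  rw [hM]
  simp only [randomState_succ, randomState_zero]
  rfl

lemma quenched_two (hM : M.Represents P H) (t s : ℝ) (F : SpinConfig Λ → SpinConfig Λ → ℝ) :
    quenched P M.β H ![t, s] (fun σ => F (σ 0) (σ 1))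
      = ∫ g, M.av t g (fun x => M.av s g fun y => F x y) ∂stdGaussianPi (κ ⊕ κ) := by
  rw [hM]
  simp only [randomState_succ, randomState_zero]
  rfl

lemma quenched_three (hM : M.Represents P H) (t s r : ℝ)
    (F : SpinConfig Λ → SpinConfig Λ → SpinConfig Λ → ℝ) :
    quenched P M.β H ![t, s, r] (fun σ => F (σ 0) (σ 1) (σ 2))
      = ∫ g, M.av t g (fun x => M.av s g fun y => M.av r g fun z => F x y z)
        ∂stdGaussianPi (κ ⊕ κ) := by
  rw [hM]
  simp only [randomState_succ, randomState_zero]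
  rfl

lemma quenched_four (hM : M.Represents P H) (t s r q : ℝ)
    (F : SpinConfig Λ → SpinConfig Λ → SpinConfig Λ → SpinConfig Λ → ℝ) :
    quenched P M.β H ![t, s, r, q] (fun σ => F (σ 0) (σ 1) (σ 2) (σ 3))
      = ∫ g, M.av t g (fun x => M.av s g fun y => M.av r g fun z => M.av q g fun u => F x y z u)
        ∂stdGaussianPi (κ ⊕ κ) := by
  rw [hM]
  simp only [randomState_succ, randomState_zero]
  rfl

lemma quenched_C_sq (hM : M.Represents P H) (t s : ℝ) :
    quenched P M.β H ![t, s] (fun σ => M.C (σ 0) (σ 1) ^ 2)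
      = ∫ g, M.overlapSq t s g ∂stdGaussianPi (κ ⊕ κ) :=
  hM.quenched_two t s fun x y => M.C x y ^ 2

lemma quenched_C_mul_C (hM : M.Represents P H) (t s : ℝ) :
    quenched P M.β H ![t, s, t] (fun σ => M.C (σ 0) (σ 1) * M.C (σ 1) (σ 2))
      = ∫ g, M.overlapChain t s g ∂stdGaussianPi (κ ⊕ κ) := by
  simp only [overlapChain_eq_av]
  exact hM.quenched_three t s t fun x y z => M.C x y * M.C y z

lemma quenched_C_mul_C_disjoint (hM : M.Represents P H) (t s : ℝ) :
    quenched P M.β H ![t, s, s, t] (fun σ => M.C (σ 0) (σ 1) * M.C (σ 2) (σ 3))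
      = ∫ g, M.overlap t s g ^ 2 ∂stdGaussianPi (κ ⊕ κ) := by
  simp only [overlap_sq_eq_av]
  exact hM.quenched_four t s s t fun x y z u => M.C x y * M.C z u

lemma quenched_bulk_mul_bulk (hM : M.Represents P H) (t s : ℝ) :
    quenched P M.β H ![t, s] (fun σ => M.bulk (σ 0) * M.bulk (σ 1))
      = ∫ g, M.av t g M.bulk * M.av s g M.bulk ∂stdGaussianPi (κ ⊕ κ) := by
  rw [hM.quenched_two t s fun x y => M.bulk x * M.bulk y]
  simp only [av, gibbsAvg_const_mul, gibbsAvg_mul_const]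

lemma quenched_bulk_mul_C_sub (hM : M.Represents P H) (t s : ℝ) :
    quenched P M.β H ![t, s] (fun σ => M.bulk (σ 0) * M.C (σ 0) (σ 1))
        - quenched P M.β H ![t, s, t] (fun σ => M.bulk (σ 0) * M.C (σ 1) (σ 2))
      = ∫ g, M.mixed t s g ∂stdGaussianPi (κ ⊕ κ) := by
  have pair : PolyGrowth fun (_ : Unit) g =>
      M.av t g fun x => M.av s g fun y => M.bulk x * M.C x y :=
    M.polyGrowth_av continuous_const fun x => M.polyGrowth_av_const continuous_const _
  have triple : PolyGrowth fun (_ : Unit) g =>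
      M.av t g fun x => M.av s g fun y => M.av t g fun z => M.bulk x * M.C y z :=
    M.polyGrowth_av continuous_const fun x => M.polyGrowth_av continuous_const fun y =>
      M.polyGrowth_av_const continuous_const _
  simp only [mixed_eq_av_sub_av]
  rw [integral_sub (pair.integrable ()) (triple.integrable ()),
    hM.quenched_two t s fun x y => M.bulk x * M.C x y,
    hM.quenched_three t s t fun x y z => M.bulk x * M.C y z]

lemma overlapFunctional_eq (hM : M.Represents P H) :
    overlapFunctional P M.β H M.C = M.overlapIntegral := by
  simp only [overlapFunctional, hM.quenched_C_sq, hM.quenched_C_mul_C,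
    hM.quenched_C_mul_C_disjoint, overlapIntegral_eq, k₂]

lemma flipFunctional_eq (hM : M.Represents P H)
    (hθ : ∀ t, deriv M.θ t = Real.cos t - Real.sin t) :
    flipFunctional P M.β H M.bulk M.C = M.β ^ 2 * M.bulkIntegral
      + 2 * M.β ^ 3 * M.mixedIntegral - M.β ^ 4 * M.overlapIntegral := by
  simp only [flipFunctional, hM.quenched_bulk_mul_bulk, hM.quenched_one,
    hM.quenched_bulk_mul_C_sub, hM.quenched_C_sq, hM.quenched_C_mul_C,
    hM.quenched_C_mul_C_disjoint, bulkIntegral, mixedIntegral, overlapIntegral_eq_swap, hθ, h₁,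
    h₂, k₂]

end Represents

end Represents

end FlipModel

/-! ### The spin glass as a flip model -/

lemma hasLaw_stdGaussianPi_map {K Ω : Type*} [Fintype K] [MeasurableSpace Ω] {P : Measure Ω}
    {Z : K → Ω → ℝ} {a : K → ℝ}
    (hZ : ∀ k, HasLaw (Z k) (gaussianReal 0 (Real.toNNReal (a k ^ 2))) P) (h : iIndepFun Z P) :
    HasLaw (fun w k => Z k w) ((stdGaussianPi K).map fun g k => a k * g k) P := by
  have scale (k : K) :
      (gaussianReal 0 1).map (a k * ·) = gaussianReal 0 (Real.toNNReal (a k ^ 2)) := by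
    rw [gaussianReal_map_const_mul, mul_zero, mul_one, Real.toNNReal_of_nonneg (sq_nonneg _)]
  have joint := h.hasLaw_pi hZ
  simp only [← scale] at joint
  rwa [← Measure.pi_map_pi fun k => (measurable_const_mul (a k)).aemeasurable] at joint

section SpinModel

variable {d : ℕ} {Λ Λ' : Finset (Site d)}

lemma abs_spinProd_le_one (X : Finset (Site d)) (σ : SpinConfig Λ) : |spinProd X σ| ≤ 1 := by
  unfold spinProd
  split_ifs
  · simp
  · rw [Finset.abs_prod]
    refine Finset.prod_le_one (fun _ _ => abs_nonneg _) fun i _ => ?_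
    rcases Int.units_eq_one_or (σ i) with h | h <;> simp [h]

lemma sum_powerset_subset_filter (h : Λ' ⊆ Λ) (f : Finset (Site d) → ℝ) :
    ∑ X : Λ.powerset with X.1 ⊆ Λ', f X.1 = ∑ X ∈ Λ'.powerset, f X := by
  rw [Finset.sum_filter, Finset.sum_coe_sort Λ.powerset fun X => if X ⊆ Λ' then f X else 0,
    ← Finset.sum_filter]
  congr 1
  ext X
  simp only [Finset.mem_filter, Finset.mem_powerset, and_iff_right_iff_imp]
  exact fun hX => hX.trans h

lemma mul_hamIn_add_mul_hamOut (h : Λ' ⊆ Λ) (a b : ℝ) (K : Finset (Site d) → ℝ)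
    (σ : SpinConfig Λ) :
    a * hamIn K Λ' σ + b * hamOut K Λ' σ
      = ∑ X : Λ.powerset, (if X.1 ⊆ Λ' then a else b) * -(K X.1 * spinProd X.1 σ) := by
  have outer : ∑ X : Λ.powerset with ¬ X.1 ⊆ Λ', K X.1 * spinProd X.1 σ
      = ∑ X ∈ Λ.powerset with ¬ X ⊆ Λ', K X * spinProd X σ := by
    rw [Finset.sum_filter, Finset.sum_filter]
    exact Finset.sum_coe_sort Λ.powerset fun X => if ¬ X ⊆ Λ' then K X * spinProd X σ else 0
  rw [hamIn, hamOut, ← sum_powerset_subset_filter h fun X => K X * spinProd X σ, ← outer,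
    Finset.sum_filter, Finset.sum_filter, ← Finset.sum_neg_distrib, ← Finset.sum_neg_distrib,
    Finset.mul_sum, Finset.mul_sum, ← Finset.sum_add_distrib]
  refine Finset.sum_congr rfl fun X _ => ?_
  split_ifs <;> simp

lemma hamIn_sub (K L : Finset (Site d) → ℝ) (Λ' : Finset (Site d)) (σ : SpinConfig Λ) :
    hamIn (fun X => K X - L X) Λ' σ = hamIn K Λ' σ - hamIn L Λ' σ := by
  simp only [hamIn, sub_mul, Finset.sum_sub_distrib]
  ring

lemma hamOut_sub (K L : Finset (Site d) → ℝ) (Λ' : Finset (Site d)) (σ : SpinConfig Λ) :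
    hamOut (fun X => K X - L X) Λ' σ = hamOut K Λ' σ - hamOut L Λ' σ := by
  simp only [hamOut, sub_mul, Finset.sum_sub_distrib]
  ring

/-- The spin glass in the volume `Λ` with the interactions inside `Λ'` rotated: the couplings are
indexed by the subsets of `Λ`, the bulk energy is the average `𝓑_{Λ'}` and the averages of the other
interactions form the remaining energy. -/
def spinModel (θ : ℝ → ℝ) (hθ : ContDiff ℝ 1 θ) (β : ℝ) (μ Δ : Finset (Site d) → ℝ)
    (Λ Λ' : Finset (Site d)) : FlipModel Λ.powerset (SpinConfig Λ) where
  β := β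
  coeff X σ := -(Δ X.1 * spinProd X.1 σ)
  region := {X | X.1 ⊆ Λ'}
  bulk := hamIn μ Λ'
  rest := hamOut μ Λ'
  θ := θ
  contDiff_θ := hθ

/-- The finite set of sites carrying a coupling, whether original or copy. -/
def couplingSupport : Λ.powerset ⊕ Λ.powerset → Finset (Site d) :=
  Sum.elim Subtype.val Subtype.val

/-- The centered couplings in the volume `Λ`, those of `J` followed by those of its copy `Jt`. -/
def centeredCouplings {Ω : Type*} (μ : Finset (Site d) → ℝ) (J Jt : Finset (Site d) → Ω → ℝ)
    (Λ : Finset (Site d)) (w : Ω) : Λ.powerset ⊕ Λ.powerset → ℝ :=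
  Sum.elim (fun X => J X.1 w - μ X.1) fun X => Jt X.1 w - μ X.1

/-- The flip model of `flipHam`: the average rotates together with the interactions. -/
abbrev flipSpinModel (β : ℝ) (μ Δ : Finset (Site d) → ℝ) (Λ Λ' : Finset (Site d)) :
    FlipModel Λ.powerset (SpinConfig Λ) :=
  spinModel (fun t => Real.cos t + Real.sin t) (Real.contDiff_cos.add Real.contDiff_sin)
    β μ Δ Λ Λ'

variable {θ : ℝ → ℝ} {hθ : ContDiff ℝ 1 θ} {β : ℝ} {μ Δ : Finset (Site d) → ℝ}

lemma C_spinModel (h : Λ' ⊆ Λ) (σ τ : SpinConfig Λ) : (spinModel θ hθ β μ Δ Λ Λ').C σ τ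
    = ∑ X ∈ Λ'.powerset, Δ X ^ 2 * spinProd X σ * spinProd X τ := by
  rw [← sum_powerset_subset_filter h]
  refine Finset.sum_congr rfl fun X _ => ?_
  simp only [spinModel]
  ring

/-- The flip model of `centeredFlipHam`: the average is not rotated. -/
abbrev centeredFlipSpinModel (β : ℝ) (μ Δ : Finset (Site d) → ℝ) (Λ Λ' : Finset (Site d)) :
    FlipModel Λ.powerset (SpinConfig Λ) :=
  spinModel (fun _ => 1) contDiff_const β μ Δ Λ Λ'

lemma energy_spinModel_eq_unit (t : ℝ) (g : Λ.powerset ⊕ Λ.powerset → ℝ) :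
    (spinModel θ hθ β μ Δ Λ Λ').energy t g
      = (spinModel θ hθ β μ 1 Λ Λ').energy t fun k => Δ (couplingSupport k) * g k := by
  funext σ
  simp only [FlipModel.energy, spinModel, Pi.one_apply, one_mul]
  congr 2
  refine Finset.sum_congr rfl fun k _ => ?_
  rcases k with X | X <;>
    simp only [FlipModel.dir, couplingSupport, Sum.elim_inl, Sum.elim_inr] <;>
    split_ifs <;> ring

lemma energy_unit_spinModel (h : Λ' ⊆ Λ) (K Kt : Finset (Site d) → ℝ) (t : ℝ)
    (σ : SpinConfig Λ) : (spinModel θ hθ β μ 1 Λ Λ').energy t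
      (Sum.elim (fun X => K X.1) fun X => Kt X.1) σ
    = Real.cos t * hamIn K Λ' σ + Real.sin t * hamIn Kt Λ' σ + hamOut K Λ' σ
      + θ t * hamIn μ Λ' σ + hamOut μ Λ' σ := by
  have original := mul_hamIn_add_mul_hamOut h (Real.cos t) 1 K σ
  have copy := mul_hamIn_add_mul_hamOut h (Real.sin t) 0 Kt σ
  rw [one_mul] at original
  rw [zero_mul, add_zero] at copy
  rw [add_right_comm (Real.cos t * _), original, copy]
  simp only [FlipModel.energy, Fintype.sum_sum_type, spinModel, FlipModel.dir, Sum.elim_inl,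
    Sum.elim_inr, Pi.one_apply, one_mul, Finset.mem_filter, Finset.mem_univ, true_and]
  congr 3
  all_goals
    refine Finset.sum_congr rfl fun X _ => ?_
    split_ifs <;> ring

section Disorder

variable {Ω : Type*} {J Jt : Finset (Site d) → Ω → ℝ}

lemma centeredFlipHam_eq_energy (h : Λ' ⊆ Λ) (t : ℝ) (w : Ω) :
    centeredFlipHam μ J Jt Λ Λ' t w
      = (centeredFlipSpinModel β μ 1 Λ Λ').energy t (centeredCouplings μ J Jt Λ w) := by
  funext σ
  rw [centeredCouplings, energy_unit_spinModel h (fun X => J X w - μ X) fun X => Jt X w - μ X,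
    hamOut_sub, centeredFlipHam]
  ring

lemma flipHam_eq_energy (h : Λ' ⊆ Λ) (t : ℝ) (w : Ω) :
    flipHam J Jt Λ Λ' t w
      = (flipSpinModel β μ 1 Λ Λ').energy t (centeredCouplings μ J Jt Λ w) := by
  funext σ
  rw [centeredCouplings, energy_unit_spinModel h (fun X => J X w - μ X) fun X => Jt X w - μ X,
    hamOut_sub, hamIn_sub, hamIn_sub, flipHam]
  ring

variable [MeasurableSpace Ω] {P : Measure Ω}

lemma IsGaussianDisorder.hasLaw_centeredCouplings (hJ : IsGaussianDisorder P μ Δ J Jt)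
    (Λ : Finset (Site d)) : HasLaw (centeredCouplings μ J Jt Λ)
      ((stdGaussianPi (Λ.powerset ⊕ Λ.powerset)).map fun g k => Δ (couplingSupport k) * g k) P := by
  refine hasLaw_stdGaussianPi_map (Z := fun k w => centeredCouplings μ J Jt Λ w k)
    (fun k => ?_) ?_
  · rw [← sub_self (μ (couplingSupport k))]
    rcases k with X | X
    · exact gaussianReal_sub_const (hJ.law X.1) (μ X.1)
    · exact gaussianReal_sub_const (hJ.law_copy X.1) (μ X.1)
  · have restrict : Function.Injective
        (Sum.map Subtype.val Subtype.val : Λ.powerset ⊕ Λ.powerset → _) :=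
      Sum.map_injective.2 ⟨Subtype.val_injective, Subtype.val_injective⟩
    convert (hJ.indep.precomp restrict).comp (fun k z => z - μ (couplingSupport k))
      fun k => measurable_id.sub_const _ using 1
    ext (X | X) <;> rfl

lemma represents_spinModel (hJ : IsGaussianDisorder P μ Δ J Jt)
    {H : ℝ → Ω → SpinConfig Λ → ℝ}
    (hH : ∀ t w, H t w = (spinModel θ hθ β μ 1 Λ Λ').energy t
        (centeredCouplings μ J Jt Λ w)) :
    (spinModel θ hθ β μ Δ Λ Λ').Represents P H := by
  intro n t f
  have continuous_state : Continuous fun z =>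
      randomState β (fun k => (spinModel θ hθ β μ 1 Λ Λ').energy (t k) z) f :=
    continuous_randomState (fun k σ => ((spinModel θ hθ β μ 1 Λ Λ').continuous_energy
      continuous_id σ).comp (.prodMk_right (t k))) f
  have transfer := (hJ.hasLaw_centeredCouplings Λ).integral_comp
    continuous_state.aestronglyMeasurable
  have scaling : Measurable fun (g : Λ.powerset ⊕ Λ.powerset → ℝ) k =>
      Δ (couplingSupport k) * g k :=
    measurable_pi_lambda _ fun k => (measurable_pi_apply k).const_mul _
  rw [integral_map scaling.aemeasurable continuous_state.aestronglyMeasurable] at transfer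
  simp only [quenched, hH, energy_spinModel_eq_unit (Δ := Δ)]
  exact transfer

lemma represents_centeredFlipHam (hJ : IsGaussianDisorder P μ Δ J Jt) (h : Λ' ⊆ Λ) :
    (centeredFlipSpinModel β μ Δ Λ Λ').Represents P (centeredFlipHam μ J Jt Λ Λ') :=
  represents_spinModel hJ (centeredFlipHam_eq_energy h)

lemma represents_flipHam (hJ : IsGaussianDisorder P μ Δ J Jt) (h : Λ' ⊆ Λ) :
    (flipSpinModel β μ Δ Λ Λ').Represents P (flipHam J Jt Λ Λ') :=
  represents_spinModel hJ (flipHam_eq_energy h)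

end Disorder

end SpinModel

/-! ### The thermodynamic limit -/

section Bounds

variable {d : ℕ} {Λ Λ' : Finset (Site d)} {β : ℝ} {μ Δ : Finset (Site d) → ℝ}

lemma magn_eq (μ : Finset (Site d) → ℝ) (Λ' : Finset (Site d)) :
    (magn μ Λ' : SpinConfig Λ → ℝ) = fun σ => (Λ'.card : ℝ)⁻¹ * hamIn μ Λ' σ :=
  funext fun _ => div_eq_inv_mul _ _

lemma abs_hamIn_le (μ : Finset (Site d) → ℝ) (Λ' : Finset (Site d)) (σ : SpinConfig Λ) :
    |hamIn μ Λ' σ| ≤ ∑ X ∈ Λ'.powerset, |μ X| := by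
  rw [hamIn, abs_neg]
  refine (Finset.abs_sum_le_sum_abs _ _).trans (Finset.sum_le_sum fun X _ => ?_)
  rw [abs_mul]
  exact mul_le_of_le_one_right (abs_nonneg _) (abs_spinProd_le_one X σ)

section SpinModel

variable {θ : ℝ → ℝ} {hθ : ContDiff ℝ 1 θ}

lemma cov_eq_C (h : Λ' ⊆ Λ) : (cov Δ Λ' : SpinConfig Λ → SpinConfig Λ → ℝ)
    = fun σ τ => (Λ'.card : ℝ)⁻¹ * (spinModel θ hθ β μ Δ Λ Λ').C σ τ := by
  funext σ τ
  rw [C_spinModel h, cov, div_eq_inv_mul]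

lemma abs_coeff_spinModel_le (X : Λ.powerset) (σ : SpinConfig Λ) :
    |(spinModel θ hθ β μ Δ Λ Λ').coeff X σ| ≤ |Δ X.1| := by
  rw [spinModel, abs_neg, abs_mul]
  exact mul_le_of_le_one_right (abs_nonneg _) (abs_spinProd_le_one X.1 σ)

lemma sum_region_spinModel (h : Λ' ⊆ Λ) :
    ∑ X ∈ (spinModel θ hθ β μ Δ Λ Λ').region, |Δ X.1| ^ 2 = ∑ X ∈ Λ'.powerset, Δ X ^ 2 := by
  simp only [sq_abs]
  exact sum_powerset_subset_filter h fun X => Δ X ^ 2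

lemma sum_couplings_sq (Δ : Finset (Site d) → ℝ) (Λ : Finset (Site d)) :
    ∑ X : Λ.powerset, |Δ X.1| ^ 2 = ∑ X ∈ Λ.powerset, Δ X ^ 2 := by
  simp only [sq_abs]
  exact Finset.sum_coe_sort Λ.powerset fun X => Δ X ^ 2

end SpinModel

lemma cos_sub_sin_nonneg {t : ℝ} (ht : t ∈ Set.Icc 0 (Real.pi / 4)) :
    0 ≤ Real.cos t - Real.sin t := by
  have sin_le := Real.sin_le_sin_of_le_of_le_pi_div_two
    (by linarith [ht.1, Real.pi_pos]) (by linarith [Real.pi_pos]) ht.2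
  have le_cos := Real.cos_le_cos_of_nonneg_of_le_pi ht.1 (by linarith [Real.pi_pos]) ht.2
  rw [Real.sin_pi_div_four] at sin_le
  rw [Real.cos_pi_div_four] at le_cos
  linarith

lemma cos_sub_sin_nonpos {t : ℝ} (ht : t ∈ Set.Icc (Real.pi / 4) Real.pi) :
    Real.cos t - Real.sin t ≤ 0 := by
  have hpi := Real.pi_pos
  rcases le_total t (Real.pi / 2) with h | h
  · have le_sin := Real.sin_le_sin_of_le_of_le_pi_div_two (by linarith) h ht.1
    have cos_le := Real.cos_le_cos_of_nonneg_of_le_pi (by linarith) ht.2 ht.1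
    rw [Real.sin_pi_div_four] at le_sin
    rw [Real.cos_pi_div_four] at cos_le
    linarith
  · have sin_nonneg := Real.sin_nonneg_of_nonneg_of_le_pi (by linarith) ht.2
    have cos_nonpos := Real.cos_nonpos_of_pi_div_two_le_of_le h (by linarith [ht.2])
    linarith

lemma deriv_cos_add_sin (t : ℝ) :
    deriv (fun t => Real.cos t + Real.sin t) t = Real.cos t - Real.sin t := by
  rw [deriv_fun_add Real.differentiableAt_cos Real.differentiableAt_sin, Real.deriv_cos,
    Real.deriv_sin]
  ring

lemma abs_mul_abs_mixedIntegral_flipSpinModel_le (h : Λ' ⊆ Λ) {δ : ℝ} (hδ : 0 < δ) :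
    |β| * |(flipSpinModel β μ Δ Λ Λ').mixedIntegral|
      ≤ Real.pi * ((∑ X ∈ Λ'.powerset, Δ X ^ 2)
        * (|β| * (δ / 2) * (∫ t in (0 : ℝ)..Real.pi, |Real.cos t - Real.sin t|)
          + 2 * (∑ X ∈ Λ'.powerset, |μ X|) / δ)) := by
  have deriv_θ : deriv (flipSpinModel β μ Δ Λ Λ').θ = fun t => Real.cos t - Real.sin t :=
    funext deriv_cos_add_sin
  have bound := (flipSpinModel β μ Δ Λ Λ').abs_mul_abs_mixedIntegral_le hδ (abs_hamIn_le μ Λ')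
    (fun σ τ => ((flipSpinModel β μ Δ Λ Λ').abs_C_le abs_coeff_spinModel_le σ τ).trans_eq
      (sum_region_spinModel h))
    (c := Real.pi / 4) ⟨by positivity, by linarith [Real.pi_pos]⟩
    (fun t ht => by rw [deriv_θ]; exact cos_sub_sin_nonneg ht)
    (fun t ht => by rw [deriv_θ]; exact cos_sub_sin_nonpos ht)
  rwa [deriv_θ] at bound

variable {Ω : Type*} [MeasurableSpace Ω] {P : Measure Ω} {J Jt : Finset (Site d) → Ω → ℝ}

lemma abs_overlapFunctional_le (hJ : IsGaussianDisorder P μ Δ J Jt) (hβ : β ≠ 0) (h : Λ' ⊆ Λ) :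
    |overlapFunctional P β (centeredFlipHam μ J Jt Λ Λ') (cov Δ Λ')|
      ≤ (4 + Real.pi ^ 2) / β ^ 2 * ((∑ X ∈ Λ'.powerset, Δ X ^ 2) / (Λ'.card : ℝ) ^ 2) := by
  set M := centeredFlipSpinModel β μ Δ Λ Λ'
  have key : β ^ 4 * |M.overlapIntegral|
      ≤ β ^ 2 * ((4 + Real.pi ^ 2) * ∑ X ∈ Λ'.powerset, Δ X ^ 2) := by
    rw [← sum_region_spinModel h]
    exact M.abs_overlapIntegral_le (fun t => deriv_const t 1) abs_coeff_spinModel_le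
  have overlap_le : |M.overlapIntegral|
      ≤ (4 + Real.pi ^ 2) / β ^ 2 * ∑ X ∈ Λ'.powerset, Δ X ^ 2 := by
    rw [div_mul_eq_mul_div, le_div_iff₀ (by positivity)]
    refine le_of_mul_le_mul_left ?_ (by positivity : 0 < β ^ 2)
    linarith
  have functional_eq : overlapFunctional P β (centeredFlipHam μ J Jt Λ Λ') M.C
      = M.overlapIntegral := (represents_centeredFlipHam hJ h).overlapFunctional_eq
  rw [cov_eq_C (hθ := contDiff_const) h, overlapFunctional_const_mul, functional_eq, abs_mul,
    abs_of_nonneg (by positivity), inv_pow, ← mul_div_assoc, div_eq_inv_mul]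
  gcongr

lemma abs_flipFunctional_le (hJ : IsGaussianDisorder P μ Δ J Jt) (h : Λ' ⊆ Λ) {δ : ℝ}
    (hδ : 0 < δ) :
    |flipFunctional P β (flipHam J Jt Λ Λ') (magn μ Λ') (cov Δ Λ')|
      ≤ β ^ 2 / (Λ'.card : ℝ) ^ 2 * (4 * (∑ X ∈ Λ.powerset, Δ X ^ 2)
        + (∑ X ∈ Λ'.powerset, Δ X ^ 2) * (Real.pi ^ 2 + 4 * Real.pi
          * (|β| * (δ / 2) * (∫ t in (0 : ℝ)..Real.pi, |Real.cos t - Real.sin t|)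
            + 2 * (∑ X ∈ Λ'.powerset, |μ X|) / δ))) := by
  have mixed := mul_le_mul_of_nonneg_left
    (abs_mul_abs_mixedIntegral_flipSpinModel_le (β := β) (μ := μ) (Δ := Δ) h hδ)
    (by positivity : 0 ≤ 4 * β ^ 2)
  set M := flipSpinModel β μ Δ Λ Λ'
  have identity := M.abs_flip_identity_le abs_coeff_spinModel_le
  rw [sum_region_spinModel h, sum_couplings_sq] at identity
  have cube : 4 * |β| ^ 3 * |M.mixedIntegral| = 4 * β ^ 2 * (|β| * |M.mixedIntegral|) := by
    rw [← sq_abs β]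
    ring
  have functional_eq : flipFunctional P β (flipHam J Jt Λ Λ') (hamIn μ Λ') M.C
      = β ^ 2 * M.bulkIntegral + 2 * β ^ 3 * M.mixedIntegral - β ^ 4 * M.overlapIntegral :=
    (represents_flipHam hJ h).flipFunctional_eq deriv_cos_add_sin
  rw [magn_eq, cov_eq_C (hθ := Real.contDiff_cos.add Real.contDiff_sin) h,
    flipFunctional_const_mul, functional_eq, abs_mul, abs_of_nonneg (by positivity),
    inv_pow, div_mul_eq_mul_div, div_eq_inv_mul]
  gcongr
  change |β ^ 2 * _ + 2 * β ^ 3 * _ - β ^ 4 * _| ≤ β ^ 2 * _ + 4 * |β| ^ 3 * _ at identity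
  linarith

lemma abs_flipFunctional_le_of_sum_le (hJ : IsGaussianDisorder P μ Δ J Jt) (h : Λ' ⊆ Λ)
    (hΛ' : Λ'.Nonempty) {c : ℝ} (hμ : ∑ X ∈ Λ'.powerset, |μ X| ≤ c * Λ'.card)
    (hΔ' : ∑ X ∈ Λ'.powerset, Δ X ^ 2 ≤ c * Λ'.card)
    (hΔ : ∑ X ∈ Λ.powerset, Δ X ^ 2 ≤ c * Λ.card) :
    |flipFunctional P β (flipHam J Jt Λ Λ') (magn μ Λ') (cov Δ Λ')|
      ≤ β ^ 2 * c * (4 * ((Λ.card : ℝ) / (Λ'.card : ℝ) ^ 2) + Real.pi ^ 2 * (Λ'.card : ℝ)⁻¹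
        + 4 * Real.pi * (|β| / 2 * (∫ t in (0 : ℝ)..Real.pi, |Real.cos t - Real.sin t|) + 2 * c)
          * (√(Λ'.card : ℝ))⁻¹) := by
  have sqrt_pos : 0 < √(Λ'.card : ℝ) := Real.sqrt_pos.2 (Nat.cast_pos.2 hΛ'.card_pos)
  have volume_nonneg : 0 ≤ c * Λ'.card := (Finset.sum_nonneg fun _ _ => abs_nonneg _).trans hμ
  have bound := abs_flipFunctional_le (β := β) hJ h sqrt_pos
  have integral_nonneg : 0 ≤ ∫ t in (0 : ℝ)..Real.pi, |Real.cos t - Real.sin t| :=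
    intervalIntegral.integral_nonneg Real.pi_pos.le fun _ _ => abs_nonneg _
  generalize ∫ t in (0 : ℝ)..Real.pi, |Real.cos t - Real.sin t| = D at bound integral_nonneg ⊢
  calc |flipFunctional P β (flipHam J Jt Λ Λ') (magn μ Λ') (cov Δ Λ')|
    _ ≤ β ^ 2 / (Λ'.card : ℝ) ^ 2 * (4 * (c * Λ.card)
        + (c * Λ'.card) * (Real.pi ^ 2 + 4 * Real.pi
          * (|β| * (√(Λ'.card : ℝ) / 2) * D + 2 * (c * Λ'.card) / √(Λ'.card : ℝ)))) := by
      refine bound.trans ?_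
      gcongr
    _ = _ := by
      have card_eq : (Λ'.card : ℝ) = √(Λ'.card : ℝ) ^ 2 := (Real.sq_sqrt (Nat.cast_nonneg _)).symm
      generalize √(Λ'.card : ℝ) = s at card_eq sqrt_pos ⊢
      rw [card_eq]
      field_simp
      ring

end Bounds

section Limit

variable {d : ℕ} {μ Δ : Finset (Site d) → ℝ}

lemma ThermoStable.exists_sum_le (h : ThermoStable μ Δ) :
    ∃ c : ℝ, ∀ Λ : Finset (Site d), Λ.Nonempty →
      ∑ X ∈ Λ.powerset, |μ X| ≤ c * Λ.card ∧ ∑ X ∈ Λ.powerset, Δ X ^ 2 ≤ c * Λ.card := by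
  obtain ⟨c, hc⟩ := h
  refine ⟨c, fun Λ hΛ => ?_⟩
  have card_pos : (0 : ℝ) < Λ.card := Nat.cast_pos.2 hΛ.card_pos
  simpa only [div_le_iff₀ card_pos] using hc Λ hΛ

lemma tendsto_card_atTop_of_tendsto_atTop {α ι : Type*} [Infinite α] {l : Filter ι}
    {Λ : ι → Finset α} (h : Tendsto Λ l atTop) : Tendsto (fun i => (Λ i).card) l atTop := by
  refine tendsto_atTop.2 fun n => ?_
  obtain ⟨A, hA⟩ := Infinite.exists_subset_card_eq α n
  filter_upwards [h.eventually_ge_atTop A] with i hi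
  exact hA ▸ Finset.card_le_card hi

lemma tendsto_div_sq_zero_of_tendsto_div {ι : Type*} {l : Filter ι} {u v : ι → ℝ} {a : ℝ}
    (ha : a ≠ 0) (h : Tendsto (fun i => v i / u i) l (𝓝 a)) (hv : Tendsto v l atTop) :
    Tendsto (fun i => u i / v i ^ 2) l (𝓝 0) := by
  simpa [div_eq_mul_inv, pow_two, mul_assoc] using
    (h.inv₀ ha).mul (tendsto_inv_atTop_zero.comp hv)

lemma infinite_site (hd : 0 < d) : Infinite (Site d) :=
  have : Nonempty (Fin d) := ⟨⟨0, hd⟩⟩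
  Pi.infinite_of_right

theorem theorem1_general {Ω : Type*} [MeasurableSpace Ω] {P : Measure Ω}
    {J Jt : Finset (Site d) → Ω → ℝ} (hJ : IsGaussianDisorder P μ Δ J Jt)
    (hstab : ThermoStable μ Δ) {β : ℝ} (hβ : β ≠ 0) {ι : Type*} {l : Filter ι}
    {Λ Λ' : ι → Finset (Site d)} (hsub : ∀ i, Λ' i ⊆ Λ i)
    (hcard : Tendsto (fun i => (Λ' i).card) l atTop) :
    Tendsto (fun i =>
      overlapFunctional P β (centeredFlipHam μ J Jt (Λ i) (Λ' i)) (cov Δ (Λ' i))) l (𝓝 0) ∧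
    (Tendsto (fun i => ((Λ i).card : ℝ) / ((Λ' i).card : ℝ) ^ 2) l (𝓝 0) →
      Tendsto (fun i => flipFunctional P β (flipHam J Jt (Λ i) (Λ' i)) (magn μ (Λ' i))
        (cov Δ (Λ' i))) l (𝓝 0)) := by
  obtain ⟨c, hc⟩ := hstab.exists_sum_le
  have nonempty : ∀ᶠ i in l, (Λ' i).Nonempty :=
    (hcard.eventually_gt_atTop 0).mono fun _ => Finset.card_pos.1
  have card_atTop : Tendsto (fun i => ((Λ' i).card : ℝ)) l atTop :=
    tendsto_natCast_atTop_atTop.comp hcard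
  have inv_card := tendsto_inv_atTop_zero.comp card_atTop
  refine ⟨?_, fun hratio => ?_⟩
  · refine squeeze_zero_norm' ?_
      (by simpa only [mul_zero] using inv_card.const_mul ((4 + Real.pi ^ 2) / β ^ 2 * c))
    filter_upwards [nonempty] with i hi
    refine (abs_overlapFunctional_le hJ hβ (hsub i)).trans ?_
    have : (0 : ℝ) < (Λ' i).card := Nat.cast_pos.2 hi.card_pos
    rw [mul_assoc]
    gcongr
    rw [Function.comp_apply, div_le_iff₀ (by positivity)]
    exact (hc _ hi).2.trans_eq (by field_simp)
  · have inv_sqrt := tendsto_inv_atTop_zero.comp (Real.tendsto_sqrt_atTop.comp card_atTop)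
    refine squeeze_zero_norm' ?_ (by simpa only [mul_zero, add_zero] using
      (((hratio.const_mul 4).add (inv_card.const_mul (Real.pi ^ 2))).add
        (inv_sqrt.const_mul (4 * Real.pi * (|β| / 2
          * (∫ t in (0 : ℝ)..Real.pi, |Real.cos t - Real.sin t|) + 2 * c)))).const_mul (β ^ 2 * c))
    filter_upwards [nonempty] with i hi
    exact abs_flipFunctional_le_of_sum_le hJ (hsub i) hi (hc _ hi).1 (hc _ hi).2
      (hc _ (hi.mono (hsub i))).2

end Limit

end

end FlipSpinGlass

open FlipSpinGlass in
theorem theorem1 {d : ℕ} (hd : 0 < d) {Ω : Type*} [MeasurableSpace Ω] (P : Measure Ω)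
    [IsProbabilityMeasure P] (μ Δ : Finset (Site d) → ℝ) (J Jt : Finset (Site d) → Ω → ℝ)
    (hJ : IsGaussianDisorder P μ Δ J Jt) (hstab : ThermoStable μ Δ)
    (β : ℝ) (hβ : 0 < β)
    {ι : Type*} (l : Filter ι) (Λ Λ' : ι → Finset (Site d)) (hsub : ∀ i, Λ' i ⊆ Λ i)
    (hlim : Tendsto Λ' l atTop) :
    Tendsto (fun i =>
      ∫ t in (0 : ℝ)..Real.pi, ∫ s in (0 : ℝ)..Real.pi, k₂ t s *
        (quenched P β (centeredFlipHam μ J Jt (Λ i) (Λ' i)) ![t, s]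
              (fun σ => cov Δ (Λ' i) (σ 0) (σ 1) ^ 2)
          - 2 * quenched P β (centeredFlipHam μ J Jt (Λ i) (Λ' i)) ![t, s, t]
              (fun σ => cov Δ (Λ' i) (σ 0) (σ 1) * cov Δ (Λ' i) (σ 1) (σ 2))
          + quenched P β (centeredFlipHam μ J Jt (Λ i) (Λ' i)) ![t, s, s, t]
              (fun σ => cov Δ (Λ' i) (σ 0) (σ 1) * cov Δ (Λ' i) (σ 2) (σ 3))))
      l (𝓝 0) ∧
    ∀ a : ℝ, 0 < a →
      Tendsto (fun i => ((Λ' i).card : ℝ) / ((Λ i).card : ℝ)) l (𝓝 a) →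
      Tendsto (fun i =>
        β ^ 2 * (∫ t in (0 : ℝ)..Real.pi, ∫ s in (0 : ℝ)..Real.pi, h₁ t s *
          (quenched P β (flipHam J Jt (Λ i) (Λ' i)) ![t, s]
              (fun σ => magn μ (Λ' i) (σ 0) * magn μ (Λ' i) (σ 1))
            - quenched P β (flipHam J Jt (Λ i) (Λ' i)) ![t]
              (fun σ => magn μ (Λ' i) (σ 0)) * quenched P β (flipHam J Jt (Λ i) (Λ' i)) ![s]
              (fun σ => magn μ (Λ' i) (σ 0))))
        + 2 * β ^ 3 * (∫ t in (0 : ℝ)..Real.pi, ∫ s in (0 : ℝ)..Real.pi, h₂ t s *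
          (quenched P β (flipHam J Jt (Λ i) (Λ' i)) ![t, s]
              (fun σ => magn μ (Λ' i) (σ 0) * cov Δ (Λ' i) (σ 0) (σ 1))
            - quenched P β (flipHam J Jt (Λ i) (Λ' i)) ![t, s, t]
              (fun σ => magn μ (Λ' i) (σ 0) * cov Δ (Λ' i) (σ 1) (σ 2))))
        - β ^ 4 * (∫ t in (0 : ℝ)..Real.pi, ∫ s in (0 : ℝ)..Real.pi, k₂ t s *
          (quenched P β (flipHam J Jt (Λ i) (Λ' i)) ![t, s]
              (fun σ => cov Δ (Λ' i) (σ 0) (σ 1) ^ 2)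
            - 2 * quenched P β (flipHam J Jt (Λ i) (Λ' i)) ![s, t, s]
              (fun σ => cov Δ (Λ' i) (σ 0) (σ 1) * cov Δ (Λ' i) (σ 1) (σ 2))
            + quenched P β (flipHam J Jt (Λ i) (Λ' i)) ![t, s, s, t]
              (fun σ => cov Δ (Λ' i) (σ 0) (σ 1) * cov Δ (Λ' i) (σ 2) (σ 3)))))
        l (𝓝 0) := by
  have := infinite_site hd
  have card_atTop := tendsto_card_atTop_of_tendsto_atTop hlim
  have limits := theorem1_general hJ hstab hβ.ne' hsub card_atTop
  exact ⟨limits.1, fun a ha hratio => limits.2 <|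
    tendsto_div_sq_zero_of_tendsto_div ha.ne' hratio (tendsto_natCast_atTop_atTop.comp card_atTop)⟩
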